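/- Let $d\in\mathbb N$ and fix a Littlewood–Paley cut-off $\chi$ on $\mathbb R^d$: a smooth real-valued radial function, nonincreasing in $|\xi|$, supported in the closed ball of radius $4/3$ about $0$ and equal to $1$ near the ball $B(0,3/4)$. Put $\varphi(\xi)=\chi(\xi/2)-\chi(\xi)$, $\dot\Delta_l=\varphi(2^{-l}D)$ and $\dot S_l=\chi(2^{-l}D)$ for $l\in\mathbb Z$. Let $\mathcal S'_h$ be the set of (complex-valued) tempered distributions $u$ on $\mathbb R^d$ with $\|\dot S_q u\|_{L^\infty}\to0$ as $q\to-\infty$. For $\sigma,\tau\in\mathbb R$ let $\dot B^\sigma_{2,1}$ be the set of $u\in\mathcal S'_h$ with $$\|u\|_{\dot B^\sigma_{2,1}}=\sum_{l\in\mathbb Z}2^{l\sigma}\|\dot\Delta_l u\|_{L^2}<\infty ,$$ and, for $\varepsilon>0$ and a frequency threshold $l_\varepsilon\in\mathbb Z$, let $\dot B^{\sigma,\tau}_\varepsilon$ be the set of $u\in\mathcal S'_h$ with $$\|u\|_{\dot B^{\sigma,\tau}_\varepsilon}=\sum_{l\le l_\varepsilon}2^{l\sigma}\|\dot\Delta_l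 u\|_{L^2}+\sum_{l>l_\varepsilon}\frac1{\varepsilon^2}2^{l\tau}\|\dot\Delta_l u\|_{L^2}<\infty .$$ The product $uv$ of two tempered distributions is the limit in $\mathcal S'$ of $\dot S_nu\,\dot S_nv$ as $n\to\infty$, when it exists. Let $s\le\frac d2$ and $t\le\frac d2-1$ be real numbers with $s+t>0$, and let $\varepsilon_0>0$. There is a constant $C>0$, depending only on $d,\chi,s,t,\varepsilon_0$, such that for all $\varepsilon\in(0,\varepsilon_0]$, all thresholds $l_\varepsilon\in\mathbb Z$ and all $(u,v)\in(\dot B^{s-1}_{2,1}\cap\dot B^{s}_{2,1})\times\dot B^{t+1,t}_\varepsilon$, the product $uv$ exists, belongs to $\dot B^{s+t-\frac d2}_{2,1}$, and $$\|uv\|_{\dot B^{s+t-\frac d2}_{2,1}}\le C\left(\|u\|_{\dot B^{s-1}_{2,1}}+\|u\|_{\dot B^{s}_{2,1}}\right)\|v\|_{\dot B^{t+1,t}_\varepsilon}.$$ -/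

import Mathlib

open scoped SchwartzMap ContDiff ENNReal Topology
open MeasureTheory Filter

noncomputable section

namespace LPBesov

/-- The Euclidean space `ℝ^d`. -/
abbrev Rd (d : ℕ) : Type := EuclideanSpace ℝ (Fin d)

/-- Complex-valued tempered distributions on `ℝ^d`. -/
abbrev Distr (d : ℕ) : Type := 𝓢'(Rd d, ℂ)

/-- Admissible low-frequency cut-offs: smooth, radial, radially nonincreasing, supported in
`B(0, 4/3)` and equal to `1` near `B(0, 3/4)`. -/
structure IsCutoff {d : ℕ} (χ : Rd d → ℝ) : Prop where
  smooth : ContDiff ℝ ∞ χ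
  radial : ∀ ξ η : Rd d, ‖ξ‖ = ‖η‖ → χ ξ = χ η
  antitone : ∀ ξ η : Rd d, ‖ξ‖ ≤ ‖η‖ → χ η ≤ χ ξ
  support : tsupport χ ⊆ Metric.closedBall 0 (4 / 3)
  eq_one : ∀ᶠ ξ in 𝓝ˢ (Metric.ball (0 : Rd d) (3 / 4)), χ ξ = 1

/-- The annular cut-off `φ(ξ) = χ(ξ/2) - χ(ξ)`. -/
def annulus {d : ℕ} (χ : Rd d → ℝ) (ξ : Rd d) : ℝ := χ ((2 : ℝ)⁻¹ • ξ) - χ ξ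

/-- The Fourier multiplier `m(2^{-q} D)`, where `D = -i∇`. Mathlib's Fourier transform has kernel
`exp(-2πi⟨x, ξ⟩)`, so the frequency variable of `D` is `2πξ`. -/
def dyadicMult {d : ℕ} (m : Rd d → ℝ) (q : ℤ) (u : Distr d) : Distr d :=
  TemperedDistribution.fourierMultiplierCLM ℂ
    (fun ξ : Rd d => ((m (((2 : ℝ) ^ (-q) * (2 * Real.pi)) • ξ) : ℝ) : ℂ)) u

/-- The homogeneous low-frequency cut-off `Ṡ_q = χ(2^{-q} D)`. -/
def lowFreq {d : ℕ} (χ : Rd d → ℝ) (q : ℤ) (u : Distr d) : Distr d := dyadicMult χ q u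

/-- The homogeneous dyadic block `Δ̇_q = φ(2^{-q} D)`. -/
def block {d : ℕ} (χ : Rd d → ℝ) (q : ℤ) (u : Distr d) : Distr d := dyadicMult (annulus χ) q u

/-- The distribution `T` is the function `f`, i.e. `T(φ) = ∫ φ f` for all Schwartz `φ`. -/
def IsFunction {d : ℕ} (T : Distr d) (f : Rd d → ℂ) : Prop :=
  LocallyIntegrable f ∧
    ∀ φ : 𝓢(Rd d, ℂ), Integrable (fun x => φ x * f x) ∧ T φ = ∫ x, φ x * f x

/-- The `L^p` norm of a tempered distribution; it is `∞` if the distribution is not a function. -/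
def lpNorm {d : ℕ} (p : ℝ≥0∞) (T : Distr d) : ℝ≥0∞ :=
  ⨅ (f : Rd d → ℂ) (_ : IsFunction T f), eLpNorm f p volume

/-- `T` is the pointwise product of the functions `T₁` and `T₂`. -/
def IsPointwiseProduct {d : ℕ} (T₁ T₂ T : Distr d) : Prop :=
  ∃ f g : Rd d → ℂ, IsFunction T₁ f ∧ IsFunction T₂ g ∧ IsFunction T (fun x => f x * g x)

/-- `w` is the product `uv` of the tempered distributions `u` and `v`: the limit in `𝓢'` of
`Ṡ_n u · Ṡ_n v` as `n → ∞`. -/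
def IsProduct {d : ℕ} (χ : Rd d → ℝ) (u v w : Distr d) : Prop :=
  ∃ a : ℤ → Distr d,
    (∀ n, IsPointwiseProduct (lowFreq χ n u) (lowFreq χ n v) (a n)) ∧ Tendsto a atTop (𝓝 w)

/-- The class `𝓢'_h`: `‖Ṡ_q u‖_{L^∞} → 0` as `q → -∞`. -/
def InSh {d : ℕ} (χ : Rd d → ℝ) (u : Distr d) : Prop :=
  Tendsto (fun q : ℤ => lpNorm ⊤ (lowFreq χ q u)) atBot (𝓝 0)

/-- The norm of `Ḃ^s_{2,1}`, with values in `[0, ∞]`. -/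
def besovNorm {d : ℕ} (χ : Rd d → ℝ) (s : ℝ) (u : Distr d) : ℝ≥0∞ :=
  ∑' l : ℤ, (2 : ℝ≥0∞) ^ ((l : ℝ) * s) * lpNorm 2 (block χ l u)

/-- The space `Ḃ^s_{2,1}`. -/
def InBesov {d : ℕ} (χ : Rd d → ℝ) (s : ℝ) (u : Distr d) : Prop :=
  InSh χ u ∧ besovNorm χ s u < ⊤

/-- The norm of the hybrid space `Ḃ_ε^{s,t}` with frequency threshold `L` (that is `l_ε = L`),
with values in `[0, ∞]`. -/
def hybridNorm {d : ℕ} (χ : Rd d → ℝ) (ε : ℝ) (L : ℤ) (s t : ℝ) (u : Distr d) : ℝ≥0∞ :=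
  (∑' l : {l : ℤ // l ≤ L}, (2 : ℝ≥0∞) ^ (((l : ℤ) : ℝ) * s) * lpNorm 2 (block χ l u)) +
    ∑' l : {l : ℤ // L < l}, ENNReal.ofReal (1 / ε ^ 2) *
      ((2 : ℝ≥0∞) ^ (((l : ℤ) : ℝ) * t) * lpNorm 2 (block χ l u))

/-- The hybrid space `Ḃ_ε^{s,t}` with frequency threshold `L`. -/
def InHybrid {d : ℕ} (χ : Rd d → ℝ) (ε : ℝ) (L : ℤ) (s t : ℝ) (u : Distr d) : Prop :=
  InSh χ u ∧ hybridNorm χ ε L s t u < ⊤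

/-- The function representing a distribution is unique. -/
theorem IsFunction.ae_eq {d : ℕ} {T : Distr d} {f g : Rd d → ℂ} (hf : IsFunction T f)
    (hg : IsFunction T g) : f =ᵐ[volume] g := by
  refine ae_eq_of_integral_contDiff_smul_eq hf.1 hg.1 fun h hh hc => ?_
  have hh' : ContDiff ℝ ∞ (fun x => (h x : ℂ)) := Complex.ofRealCLM.contDiff.comp hh
  have hc' : HasCompactSupport (fun x => (h x : ℂ)) := hc.comp_left Complex.ofReal_zero
  have := (hf.2 (hc'.toSchwartzMap hh')).2.symm.trans (hg.2 (hc'.toSchwartzMap hh')).2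
  simpa [Complex.real_smul] using this

/-- The product of two distributions is unique. -/
theorem IsProduct.unique {d : ℕ} {χ : Rd d → ℝ} {u v w w' : Distr d} (h : IsProduct χ u v w)
    (h' : IsProduct χ u v w') : w = w' := by
  obtain ⟨a, ha, hw⟩ := h
  obtain ⟨b, hb, hw'⟩ := h'
  have hab : a = b := by
    funext n
    obtain ⟨f, g, hf, hg, hfg⟩ := ha n
    obtain ⟨f', g', hf', hg', hfg'⟩ := hb n
    ext φ
    rw [(hfg.2 φ).2, (hfg'.2 φ).2]
    refine integral_congr_ae ?_
    filter_upwards [hf.ae_eq hf', hg.ae_eq hg'] with x h1 h2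
    simp only [h1, h2]
  subst hab
  exact tendsto_nhds_unique hw hw'

end LPBesov

end

/-!
The proof takes place on the Fourier side and avoids paraproducts.

A distribution `u ∈ 𝓢'_h` whose dyadic blocks are summable at low frequencies in the critical space
`Ḃ^{d/2}_{2,1}` has a Fourier transform that is a function `U`, integrable on bounded sets
(`IsCutoff.exists_isSpectrum`): each block is integrable on the Fourier side by Hölder's inequality
on its annulus, and the remainder `Ṡ_q u` vanishes weakly as `q → -∞`. By Plancherel the norm of the
block `Δ̇_l u` is that of `φ(2^{-l}·) U`. Since `s ≤ d/2` and `t + 1 ≤ d/2`, both factors have such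
spectra `U` and `V`, and the product is the inverse Fourier transform of the convolution of `U` and
`V`. All the estimates concern the convolution of the nonnegative functions `|U|` and `|V|`.

If `F` and `G` live in the dyadic annuli of index `j` and `k`, Cauchy–Schwarz gives
`‖F * G‖_{L²(annulus l)} ≤ C 2^{min(j,k,l) d/2} ‖F‖ ‖G‖` (`l2norm_indicator_lconv_le`), and the
left-hand side vanishes unless the two largest of `j, k, l` are comparable (`dyadic_triangle`).
Summing over `l` with the weight `2^{l(s₁+s₂-d/2)}` gives at most `C 2^{j s₁ + k s₂} ‖F‖ ‖G‖` as
soon as `s₁, s₂ ≤ d/2` and `s₁ + s₂ > 0` (`exists_tsum_l2norm_indicator_lconv_le`). This applies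
both to `(s, t)` and to `(s - 1, t + 1)`, which have the same sum. Using the second pair for the
blocks of `v` below the threshold and the first pair above it, where `1 ≤ ε₀² / ε²`, yields the
hybrid bound (`exists_hybrid_block_bound`), and summation over `j` and `k` yields the theorem.

The same bound shows that `|U| * |V|` is integrable against a negative power of `1 + |ξ|²`. Hence
dominated convergence gives the convergence of `Ṡ_n u · Ṡ_n v`, whose Fourier transform is the
convolution of `χ(2^{-n}·) U` and `χ(2^{-n}·) V`, and the limit lies in `𝓢'_h` because its Fourier
transform is a function (`IsSpectrum.exists_isProduct`, `IsCutoff.inSh_of_fourier`).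
-/

open scoped FourierTransform

noncomputable section

namespace LPBesov

variable {d : ℕ} {χ : Rd d → ℝ}

/-! ### Dyadic symbols -/

/-- The symbol `m(2^{-q} · 2π ξ)` of the dyadic multiplier `m(2^{-q} D)` in Mathlib's frequency
variable. -/
def symbol (m : Rd d → ℝ) (q : ℤ) (ξ : Rd d) : ℝ := m (((2 : ℝ) ^ (-q) * (2 * Real.pi)) • ξ)

/-- The frequency annulus that carries the symbol of the `l`-th dyadic block. -/
def dyadicAnnulus (d : ℕ) (l : ℤ) : Set (Rd d) :=
  {ξ | 3 / 4 * (2 : ℝ) ^ l ≤ 2 * Real.pi * ‖ξ‖ ∧ 2 * Real.pi * ‖ξ‖ ≤ 8 / 3 * (2 : ℝ) ^ l}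

theorem norm_dilate (q : ℤ) (ξ : Rd d) :
    ‖((2 : ℝ) ^ (-q) * (2 * Real.pi)) • ξ‖ = 2 * Real.pi * ‖ξ‖ / (2 : ℝ) ^ q := by
  rw [norm_smul, Real.norm_of_nonneg (by positivity), zpow_neg]
  ring

theorem symbol_annulus (χ : Rd d → ℝ) (q : ℤ) (ξ : Rd d) :
    symbol (annulus χ) q ξ = symbol χ (q + 1) ξ - symbol χ q ξ := by
  simp only [symbol, annulus, smul_smul]
  congr 3
  rw [neg_add, zpow_add₀ two_ne_zero, zpow_neg_one]
  ring

/-- The dyadic blocks telescope. -/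
theorem sum_symbol_annulus (χ : Rd d → ℝ) (q : ℤ) (N : ℕ) (ξ : Rd d) :
    ∑ k ∈ Finset.range N, symbol (annulus χ) (q - 1 - k) ξ
      = symbol χ q ξ - symbol χ (q - N) ξ := by
  induction N with
  | zero => simp
  | succ n ih =>
    rw [Finset.sum_range_succ, ih, symbol_annulus]
    have h1 : q - 1 - (n : ℤ) + 1 = q - n := by ring
    have h2 : q - 1 - (n : ℤ) = q - ((n + 1 : ℕ) : ℤ) := by push_cast; ring
    rw [h1, h2]
    ring

namespace IsCutoff

theorem apply_eq_one (hχ : IsCutoff χ) {ξ : Rd d} (h : ‖ξ‖ < 3 / 4) : χ ξ = 1 :=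
  hχ.eq_one.self_of_nhdsSet ξ (by simpa using h)

theorem apply_eq_zero (hχ : IsCutoff χ) {ξ : Rd d} (h : 4 / 3 < ‖ξ‖) : χ ξ = 0 :=
  image_eq_zero_of_notMem_tsupport fun h' => by
    have := hχ.support h'
    simp only [Metric.mem_closedBall, dist_zero_right] at this
    linarith

theorem le_one (hχ : IsCutoff χ) (ξ : Rd d) : χ ξ ≤ 1 := by
  rw [← hχ.apply_eq_one (ξ := 0) (by norm_num)]
  exact hχ.antitone 0 ξ (by simp)

theorem nonneg (hχ : IsCutoff χ) (hd : 0 < d) (ξ : Rd d) : 0 ≤ χ ξ := by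
  have : Nonempty (Fin d) := ⟨⟨0, hd⟩⟩
  obtain ⟨η, hη⟩ := NormedSpace.exists_lt_norm ℝ (Rd d) (max ‖ξ‖ (4 / 3))
  rw [← hχ.apply_eq_zero ((le_max_right _ _).trans_lt hη)]
  exact hχ.antitone ξ η ((le_max_left _ _).trans hη.le)

theorem symbol_eq_one (hχ : IsCutoff χ) {q : ℤ} {ξ : Rd d}
    (h : 2 * Real.pi * ‖ξ‖ < 3 / 4 * (2 : ℝ) ^ q) : symbol χ q ξ = 1 :=
  hχ.apply_eq_one (by rw [norm_dilate, div_lt_iff₀ (by positivity)]; exact h)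

theorem symbol_eq_zero (hχ : IsCutoff χ) {q : ℤ} {ξ : Rd d}
    (h : 4 / 3 * (2 : ℝ) ^ q < 2 * Real.pi * ‖ξ‖) : symbol χ q ξ = 0 :=
  hχ.apply_eq_zero (by rw [norm_dilate, lt_div_iff₀ (by positivity)]; exact h)

theorem symbol_nonneg (hχ : IsCutoff χ) (hd : 0 < d) (q : ℤ) (ξ : Rd d) : 0 ≤ symbol χ q ξ :=
  hχ.nonneg hd _

theorem symbol_le_one (hχ : IsCutoff χ) (q : ℤ) (ξ : Rd d) : symbol χ q ξ ≤ 1 :=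
  hχ.le_one _

theorem symbol_mono (hχ : IsCutoff χ) {p q : ℤ} (hpq : p ≤ q) (ξ : Rd d) :
    symbol χ p ξ ≤ symbol χ q ξ := by
  refine hχ.antitone _ _ ?_
  rw [norm_dilate, norm_dilate]
  gcongr
  norm_num

theorem symbol_annulus_nonneg (hχ : IsCutoff χ) (q : ℤ) (ξ : Rd d) :
    0 ≤ symbol (annulus χ) q ξ := by
  rw [symbol_annulus, sub_nonneg]
  exact hχ.symbol_mono (by lia) ξ

theorem symbol_annulus_le_one (hχ : IsCutoff χ) (hd : 0 < d) (q : ℤ) (ξ : Rd d) :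
    symbol (annulus χ) q ξ ≤ 1 := by
  rw [symbol_annulus]
  linarith [hχ.symbol_le_one (q + 1) ξ, hχ.symbol_nonneg hd q ξ]

theorem mem_dyadicAnnulus (hχ : IsCutoff χ) {q : ℤ} {ξ : Rd d}
    (h : symbol (annulus χ) q ξ ≠ 0) : ξ ∈ dyadicAnnulus d q := by
  rw [symbol_annulus] at h
  have h2 : (2 : ℝ) ^ (q + 1) = 2 ^ q * 2 := zpow_add_one₀ two_ne_zero q
  have hp : (0 : ℝ) < 2 ^ q := by positivity
  constructor
  · by_contra! hlt
    exact h (by rw [hχ.symbol_eq_one hlt, hχ.symbol_eq_one (by linarith), sub_self])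
  · by_contra! hlt
    exact h (by rw [hχ.symbol_eq_zero (by linarith), hχ.symbol_eq_zero (by linarith), sub_self])

theorem eventually_symbol_eq_one (hχ : IsCutoff χ) (ξ : Rd d) :
    ∀ᶠ q : ℤ in atTop, symbol χ q ξ = 1 := by
  obtain ⟨n, hn⟩ := pow_unbounded_of_one_lt (2 * Real.pi * ‖ξ‖ * (4 / 3)) (one_lt_two (α := ℝ))
  filter_upwards [eventually_ge_atTop (n : ℤ)] with q hq
  have : (2 : ℝ) ^ n ≤ 2 ^ q := by
    rw [← zpow_natCast]
    exact zpow_le_zpow_right₀ one_le_two hq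
  exact hχ.symbol_eq_one (by linarith)

theorem eventually_symbol_eq_zero (hχ : IsCutoff χ) {ξ : Rd d} (hξ : ξ ≠ 0) :
    ∀ᶠ q : ℤ in atBot, symbol χ q ξ = 0 := by
  have hpos : 0 < 2 * Real.pi * ‖ξ‖ * (3 / 4) := by
    have := norm_pos_iff.2 hξ
    positivity
  obtain ⟨n, hn⟩ := exists_pow_lt_of_lt_one hpos (one_half_lt_one (α := ℝ))
  filter_upwards [eventually_le_atBot (-(n : ℤ))] with q hq
  have : (2 : ℝ) ^ q ≤ (1 / 2) ^ n := by
    rw [one_div, inv_pow, ← zpow_natCast, ← zpow_neg]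
    exact zpow_le_zpow_right₀ one_le_two hq
  exact hχ.symbol_eq_zero (by linarith)

/-- Away from the origin the dyadic blocks form a partition of unity. -/
theorem enorm_le_tsum_symbol_annulus (hχ : IsCutoff χ) {ξ : Rd d} (hξ : ξ ≠ 0) (z : ℂ) :
    ‖z‖ₑ ≤ ∑' l : ℤ, ‖(symbol (annulus χ) l ξ : ℂ) * z‖ₑ := by
  -- Only finitely many blocks are needed at `ξ`: those between a low-frequency cut-off that
  -- vanishes at `ξ` and one that equals `1` there.
  obtain ⟨q, hq⟩ := (hχ.eventually_symbol_eq_one ξ).exists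
  have hlim : Tendsto (fun N : ℕ => q - (N : ℤ)) atTop atBot :=
    tendsto_atBot_add_const_left _ q (tendsto_neg_atTop_atBot.comp tendsto_natCast_atTop_atTop)
  obtain ⟨N, hN⟩ := (hlim.eventually (hχ.eventually_symbol_eq_zero hξ)).exists
  have hsum := sum_symbol_annulus χ q N ξ
  rw [hq, hN, sub_zero] at hsum
  have hz : z = ∑ k ∈ Finset.range N, (symbol (annulus χ) (q - 1 - k) ξ : ℂ) * z := by
    rw [← Finset.sum_mul, ← Complex.ofReal_sum, hsum, Complex.ofReal_one, one_mul]
  have hinj : Function.Injective fun k : ℕ => q - 1 - (k : ℤ) := fun a b hab => by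
    simpa using hab
  calc ‖z‖ₑ = ‖∑ k ∈ Finset.range N, (symbol (annulus χ) (q - 1 - k) ξ : ℂ) * z‖ₑ := by
        rw [← hz]
    _ ≤ ∑ k ∈ Finset.range N, ‖(symbol (annulus χ) (q - 1 - k) ξ : ℂ) * z‖ₑ :=
        enorm_sum_le _ _
    _ ≤ ∑' k : ℕ, ‖(symbol (annulus χ) (q - 1 - k) ξ : ℂ) * z‖ₑ := ENNReal.sum_le_tsum _
    _ ≤ ∑' l : ℤ, ‖(symbol (annulus χ) l ξ : ℂ) * z‖ₑ :=
        ENNReal.tsum_comp_le_tsum_of_injective hinj _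

theorem symbol_contDiff (hχ : IsCutoff χ) (q : ℤ) : ContDiff ℝ ∞ (symbol χ q) :=
  hχ.smooth.comp (contDiff_const_smul _)

theorem symbol_continuous (hχ : IsCutoff χ) (q : ℤ) : Continuous (symbol χ q) :=
  (hχ.symbol_contDiff q).continuous

theorem symbol_annulus_continuous (hχ : IsCutoff χ) (q : ℤ) :
    Continuous (symbol (annulus χ) q) := by
  rw [funext (symbol_annulus χ q)]
  exact (hχ.symbol_continuous _).sub (hχ.symbol_continuous _)

theorem symbol_hasCompactSupport (hχ : IsCutoff χ) (q : ℤ) : HasCompactSupport (symbol χ q) := by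
  refine HasCompactSupport.intro
    (isCompact_closedBall (0 : Rd d) (4 / 3 * (2 : ℝ) ^ q / (2 * Real.pi))) fun ξ hξ => ?_
  simp only [Metric.mem_closedBall, dist_zero_right, not_le] at hξ
  rw [div_lt_iff₀ (by positivity)] at hξ
  exact hχ.symbol_eq_zero (by linarith)

theorem symbol_hasTemperateGrowth (hχ : IsCutoff χ) (q : ℤ) :
    (fun ξ => (symbol χ q ξ : ℂ)).HasTemperateGrowth :=
  ((hχ.symbol_hasCompactSupport q).comp_left Complex.ofReal_zero).hasTemperateGrowth
    (Complex.ofRealCLM.contDiff.comp (hχ.symbol_contDiff q))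

theorem symbol_annulus_hasTemperateGrowth (hχ : IsCutoff χ) (q : ℤ) :
    (fun ξ => (symbol (annulus χ) q ξ : ℂ)).HasTemperateGrowth := by
  have : (fun ξ => (symbol (annulus χ) q ξ : ℂ))
      = (fun ξ => (symbol χ (q + 1) ξ : ℂ)) - fun ξ => (symbol χ q ξ : ℂ) := by
    ext ξ
    simp [symbol_annulus]
  rw [this]
  exact (hχ.symbol_hasTemperateGrowth _).sub (hχ.symbol_hasTemperateGrowth _)

end IsCutoff

/-! ### Distributions given by functions, and their Fourier transforms -/

namespace IsFunction

variable {T T' : Distr d} {f g : Rd d → ℂ}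

theorem congr_ae (hf : IsFunction T f) (h : f =ᵐ[volume] g) : IsFunction T g := by
  refine ⟨hf.1.congr h, fun φ => ?_⟩
  have h' : (fun x => φ x * f x) =ᵐ[volume] fun x => φ x * g x := by
    filter_upwards [h] with x hx
    rw [hx]
  exact ⟨(hf.2 φ).1.congr h', (hf.2 φ).2.trans (integral_congr_ae h')⟩

theorem distr_eq (hf : IsFunction T f) (hf' : IsFunction T' f) : T = T' := by
  ext φ
  rw [(hf.2 φ).2, (hf'.2 φ).2]

theorem sub (hf : IsFunction T f) (hg : IsFunction T' g) :
    IsFunction (T - T') (fun x => f x - g x) := by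
  refine ⟨hf.1.sub hg.1, fun φ => ?_⟩
  simp only [mul_sub]
  refine ⟨(hf.2 φ).1.sub (hg.2 φ).1, ?_⟩
  rw [integral_sub (hf.2 φ).1 (hg.2 φ).1, ← (hf.2 φ).2, ← (hg.2 φ).2]
  rfl

theorem smulLeft {m : Rd d → ℂ} (hm : m.HasTemperateGrowth) (hf : IsFunction T f) :
    IsFunction (TemperedDistribution.smulLeftCLM ℂ m T) (fun ξ => m ξ * f ξ) := by
  refine ⟨hf.1.continuous_mul hm.1.continuous, fun φ => ?_⟩
  have h : (fun x => φ x * (m x * f x)) = fun x => SchwartzMap.smulLeftCLM ℂ m φ x * f x := by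
    ext x
    rw [SchwartzMap.smulLeftCLM_apply_apply hm, smul_eq_mul]
    ring
  rw [h]
  exact hf.2 _

theorem lpNorm_eq (hf : IsFunction T f) (p : ℝ≥0∞) : lpNorm p T = eLpNorm f p volume :=
  le_antisymm (iInf₂_le f hf) (le_iInf₂ fun _ hg => (eLpNorm_congr_ae (hf.ae_eq hg)).le)

end IsFunction

theorem exists_isFunction_of_lpNorm_lt_top {p : ℝ≥0∞} {T : Distr d} (h : lpNorm p T < ⊤) :
    ∃ f, IsFunction T f ∧ MemLp f p volume ∧ eLpNorm f p volume = lpNorm p T := by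
  simp only [lpNorm, iInf_lt_iff] at h
  obtain ⟨f, hf, hlt⟩ := h
  exact ⟨f, hf, ⟨hf.1.aestronglyMeasurable, hlt⟩, (hf.lpNorm_eq p).symm⟩

theorem isFunction_toTemperedDistribution {p : ℝ≥0∞} [hp : Fact (1 ≤ p)]
    (f : Lp ℂ p (volume : Measure (Rd d))) : IsFunction (f : Distr d) f := by
  refine ⟨(Lp.memLp f).locallyIntegrable hp.out, fun φ => ⟨?_, ?_⟩⟩
  · have := ENNReal.HolderConjugate.inv_one_sub_inv' hp.out
    exact (φ.memLp (1 - p⁻¹)⁻¹).integrable_mul (Lp.memLp f)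
  · simp

theorem isFunction_toLp {p : ℝ≥0∞} [hp : Fact (1 ≤ p)] {f : Rd d → ℂ} (hf : MemLp f p volume) :
    IsFunction (hf.toLp f : Distr d) f :=
  (isFunction_toTemperedDistribution _).congr_ae hf.coeFn_toLp

theorem continuous_fourierInv {f : Rd d → ℂ} (hf : Integrable f) : Continuous (𝓕⁻ f) :=
  VectorFourier.fourierIntegral_continuous Real.continuous_fourierChar
    (continuous_inner (𝕜 := ℝ) (E := Rd d)).neg hf

theorem norm_fourierInv_le (f : Rd d → ℂ) (x : Rd d) : ‖𝓕⁻ f x‖ ≤ ∫ ξ, ‖f ξ‖ :=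
  VectorFourier.norm_fourierIntegral_le_integral_norm _ _ _ _ _

/-- The inverse Fourier transform is symmetric, for a Schwartz function paired with an integrable
one. -/
theorem integral_fourierInv_mul_eq (φ : 𝓢(Rd d, ℂ)) {f : Rd d → ℂ} (hf : Integrable f) :
    ∫ ξ, (𝓕⁻ φ) ξ * f ξ = ∫ x, φ x * 𝓕⁻ f x := by
  have h := VectorFourier.integral_fourierIntegral_smul_eq_flip (L := innerₗ (Rd d))
    Real.continuous_fourierChar continuous_inner φ.integrable (hf.comp_neg) (μ := volume)
    (ν := volume)
  rw [flip_innerₗ] at h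
  calc ∫ ξ, (𝓕⁻ φ) ξ * f ξ = ∫ ξ, (𝓕 (φ : Rd d → ℂ)) (-ξ) * f ξ := by
        simp only [SchwartzMap.fourierInv_coe, Real.fourierInv_eq_fourier_neg]
    _ = ∫ ξ, (𝓕 (φ : Rd d → ℂ)) ξ * f (-ξ) := by
        rw [← integral_neg_eq_self]
        simp
    _ = ∫ x, φ x * 𝓕 (fun ξ => f (-ξ)) x := h
    _ = ∫ x, φ x * 𝓕⁻ f x := by rw [Real.fourierInv_eq_fourier_comp_neg]

/-- A distribution with integrable Fourier transform is given by the inversion integral. -/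
theorem IsFunction.of_fourier_integrable {T : Distr d} {f : Rd d → ℂ} (h : IsFunction (𝓕 T) f)
    (hf : Integrable f) : IsFunction T (𝓕⁻ f) := by
  refine ⟨(continuous_fourierInv hf).locallyIntegrable, fun φ => ⟨?_, ?_⟩⟩
  · exact φ.integrable.mul_bdd (c := ∫ ξ, ‖f ξ‖) (continuous_fourierInv hf).aestronglyMeasurable
      (Eventually.of_forall (norm_fourierInv_le f))
  · rw [← integral_fourierInv_mul_eq φ hf, ← (h.2 _).2]
    simp [TemperedDistribution.fourier_apply]

/-- The `L^∞` norm is at most the `L¹` norm of the Fourier transform. -/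
theorem lpNorm_top_le {T : Distr d} {f : Rd d → ℂ} (h : IsFunction (𝓕 T) f)
    (hf : Integrable f) : lpNorm ⊤ T ≤ ∫⁻ ξ, ‖f ξ‖ₑ := by
  rw [(h.of_fourier_integrable hf).lpNorm_eq, ← ofReal_integral_norm_eq_lintegral_enorm hf,
    eLpNorm_exponent_top]
  refine eLpNormEssSup_le_of_ae_bound (Eventually.of_forall (norm_fourierInv_le f))

/-- A distribution in `L²` has its Fourier transform in `L²`. -/
theorem exists_fourier_of_lpNorm_two_lt_top {T : Distr d} (h : lpNorm 2 T < ⊤) :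
    ∃ f, IsFunction (𝓕 T) f ∧ MemLp f 2 volume := by
  obtain ⟨g, hg, hg2, -⟩ := exists_isFunction_of_lpNorm_lt_top h
  have hT : T = (hg2.toLp g : Distr d) := hg.distr_eq (isFunction_toLp hg2)
  refine ⟨(𝓕 (hg2.toLp g) : Lp ℂ 2 (volume : Measure (Rd d))), ?_, Lp.memLp _⟩
  rw [hT, MeasureTheory.Lp.fourier_toTemperedDistribution_eq]
  exact isFunction_toTemperedDistribution _

/-- Plancherel's identity, read from the Fourier side. -/
theorem lpNorm_two_eq {T : Distr d} {f : Rd d → ℂ} (h : IsFunction (𝓕 T) f)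
    (hf : MemLp f 2 volume) : lpNorm 2 T = eLpNorm f 2 volume := by
  have hT : 𝓕 T = (hf.toLp f : Distr d) := h.distr_eq (isFunction_toLp hf)
  have hT' : T = (𝓕⁻ (hf.toLp f) : Lp ℂ 2 (volume : Measure (Rd d))) := by
    rw [← MeasureTheory.Lp.fourierInv_toTemperedDistribution_eq, ← hT,
      FourierTransform.fourierInv_fourier_eq]
  have hfun := isFunction_toTemperedDistribution
    (𝓕⁻ (hf.toLp f) : Lp ℂ 2 (volume : Measure (Rd d)))
  rw [← hT'] at hfun
  rw [hfun.lpNorm_eq, ← Lp.enorm_def, ← eLpNorm_congr_ae hf.coeFn_toLp, ← Lp.enorm_def]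
  have := MeasureTheory.Lp.norm_fourier_eq (𝓕⁻ (hf.toLp f) : Lp ℂ 2 (volume : Measure (Rd d)))
  rw [FourierTransform.fourier_fourierInv_eq] at this
  rw [← ofReal_norm, ← ofReal_norm, this]

theorem enorm_apply_le (T : Distr d) (φ : 𝓢(Rd d, ℂ)) (h : lpNorm ⊤ T < ⊤) :
    ‖T φ‖ₑ ≤ lpNorm ⊤ T * ∫⁻ x, ‖φ x‖ₑ := by
  obtain ⟨f, hf, -, hfT⟩ := exists_isFunction_of_lpNorm_lt_top h
  rw [(hf.2 φ).2, ← hfT, ← lintegral_const_mul _ (by fun_prop)]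
  refine (enorm_integral_le_lintegral_enorm _).trans (lintegral_mono_ae ?_)
  rw [eLpNorm_exponent_top]
  filter_upwards [enorm_ae_le_eLpNormEssSup f volume] with x hx
  rw [enorm_mul, mul_comm]
  gcongr

theorem fourier_dyadicMult (m : Rd d → ℝ) (q : ℤ) (u : Distr d) :
    𝓕 (dyadicMult m q u)
      = TemperedDistribution.smulLeftCLM ℂ (fun ξ => (symbol m q ξ : ℂ)) (𝓕 u) := by
  simp only [dyadicMult, TemperedDistribution.fourierMultiplierCLM_apply,
    FourierTransform.fourier_fourierInv_eq]
  rfl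

/-! ### Hölder's inequality on dyadic balls -/

/-- The `L²` norm of a nonnegative extended function. -/
def l2norm (F : Rd d → ℝ≥0∞) : ℝ≥0∞ := (∫⁻ ξ, F ξ ^ (2 : ℝ)) ^ (1 / 2 : ℝ)

theorem eLpNorm_two_eq_l2norm (f : Rd d → ℂ) :
    eLpNorm f 2 volume = l2norm fun ξ => ‖f ξ‖ₑ := by
  rw [eLpNorm_eq_lintegral_rpow_enorm_toReal two_ne_zero ENNReal.ofNat_ne_top]
  rfl

theorem l2norm_mono {F G : Rd d → ℝ≥0∞} (h : ∀ᵐ ξ, F ξ ≤ G ξ) : l2norm F ≤ l2norm G := by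
  unfold l2norm
  gcongr ?_ ^ (1 / 2 : ℝ)
  refine lintegral_mono_ae ?_
  filter_upwards [h] with ξ hξ
  gcongr

/-- The Cauchy–Schwarz inequality for a function that vanishes outside `A`. -/
theorem lintegral_le_rpow_volume_mul_l2norm {F : Rd d → ℝ≥0∞} (hF : AEMeasurable F)
    {A : Set (Rd d)} (hA : MeasurableSet A) (h : ∀ᵐ ξ, ξ ∉ A → F ξ = 0) :
    ∫⁻ ξ, F ξ ≤ volume A ^ (1 / 2 : ℝ) * l2norm F := by
  have key := ENNReal.lintegral_mul_le_Lp_mul_Lq volume Real.HolderConjugate.two_two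
    ((measurable_const (a := (1 : ℝ≥0∞))).indicator hA).aemeasurable hF
  refine (lintegral_mono_ae ?_).trans (key.trans ?_)
  · filter_upwards [h] with ξ hξ
    by_cases hm : ξ ∈ A
    · simp [hm]
    · simp [hξ hm]
  · refine mul_le_mul_left (ENNReal.rpow_le_rpow ?_ (by norm_num)) _
    refine (lintegral_mono fun ξ => ?_).trans (lintegral_indicator_one hA).le
    by_cases hm : ξ ∈ A <;> simp [hm]

/-- The square root of the volume of the unit ball. -/
def sqrtVolBall (d : ℕ) : ℝ≥0∞ := volume (Metric.ball (0 : Rd d) 1) ^ (1 / 2 : ℝ)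

theorem sqrtVolBall_lt_top (d : ℕ) : sqrtVolBall d < ⊤ :=
  ENNReal.rpow_lt_top_of_nonneg (by norm_num) measure_ball_lt_top.ne

theorem two_rpow_ne_top (x : ℝ) : (2 : ℝ≥0∞) ^ x ≠ ⊤ :=
  ENNReal.rpow_ne_top_of_ne_zero two_ne_zero ENNReal.ofNat_ne_top

theorem two_rpow_pos (x : ℝ) : 0 < (2 : ℝ≥0∞) ^ x :=
  ENNReal.rpow_pos two_pos ENNReal.ofNat_ne_top

theorem two_rpow_add (x y : ℝ) : (2 : ℝ≥0∞) ^ (x + y) = 2 ^ x * 2 ^ y :=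
  ENNReal.rpow_add x y two_ne_zero ENNReal.ofNat_ne_top

theorem ofReal_two_zpow (l : ℤ) : ENNReal.ofReal ((2 : ℝ) ^ l) = (2 : ℝ≥0∞) ^ (l : ℝ) := by
  rw [← Real.rpow_intCast, ← ENNReal.ofReal_rpow_of_pos two_pos]
  simp

/-- Half a power of `2^{ld}` is the price of Cauchy–Schwarz on a ball of radius `2^l`. -/
theorem sqrt_volume_closedBall (d : ℕ) (l : ℤ) :
    volume (Metric.closedBall (0 : Rd d) ((2 : ℝ) ^ l)) ^ (1 / 2 : ℝ)
      = sqrtVolBall d * (2 : ℝ≥0∞) ^ ((l : ℝ) * (d / 2)) := by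
  rw [Measure.addHaar_closedBall _ _ (by positivity), finrank_euclideanSpace_fin,
    ENNReal.ofReal_pow (by positivity), ofReal_two_zpow,
    ENNReal.mul_rpow_of_nonneg _ _ (by norm_num), mul_comm, ← ENNReal.rpow_natCast,
    ← ENNReal.rpow_mul, ← ENNReal.rpow_mul]
  congr 2
  ring

/-! ### The Fourier transform of a distribution with controlled dyadic blocks -/

/-- The function `U` represents the Fourier transform of `u` at all bounded frequencies: it is
integrable on bounded sets, and `χ(2^{-n}D) u` has Fourier transform `χ(2^{-n}·) U`. -/
structure IsSpectrum (χ : Rd d → ℝ) (u : Distr d) (U : Rd d → ℂ) : Prop where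
  measurable : Measurable U
  integrable (n : ℤ) : Integrable fun ξ => (symbol χ n ξ : ℂ) * U ξ
  isFunction (n : ℤ) : IsFunction (𝓕 (lowFreq χ n u)) fun ξ => (symbol χ n ξ : ℂ) * U ξ

theorem fourier_lowFreq (χ : Rd d → ℝ) (q : ℤ) (u : Distr d) :
    𝓕 (lowFreq χ q u)
      = TemperedDistribution.smulLeftCLM ℂ (fun ξ => (symbol χ q ξ : ℂ)) (𝓕 u) :=
  fourier_dyadicMult χ q u

theorem fourier_block (χ : Rd d → ℝ) (q : ℤ) (u : Distr d) :
    𝓕 (block χ q u)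
      = TemperedDistribution.smulLeftCLM ℂ (fun ξ => (symbol (annulus χ) q ξ : ℂ)) (𝓕 u) :=
  fourier_dyadicMult _ q u

namespace IsCutoff

theorem fourier_block_eq_sub (hχ : IsCutoff χ) (q : ℤ) (u : Distr d) :
    𝓕 (block χ q u) = 𝓕 (lowFreq χ (q + 1) u) - 𝓕 (lowFreq χ q u) := by
  have : (fun ξ => (symbol (annulus χ) q ξ : ℂ))
      = (fun ξ => (symbol χ (q + 1) ξ : ℂ)) - fun ξ => (symbol χ q ξ : ℂ) := by
    ext ξ
    simp [symbol_annulus]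
  rw [fourier_block, this, TemperedDistribution.smulLeftCLM_sub (hχ.symbol_hasTemperateGrowth _)
    (hχ.symbol_hasTemperateGrowth _), fourier_lowFreq, fourier_lowFreq]
  rfl

theorem sum_fourier_block (hχ : IsCutoff χ) (q : ℤ) (N : ℕ) (u : Distr d) :
    ∑ k ∈ Finset.range N, 𝓕 (block χ (q - 1 - k) u)
      = 𝓕 (lowFreq χ q u) - 𝓕 (lowFreq χ (q - N) u) := by
  induction N with
  | zero => simp
  | succ n ih =>
    rw [Finset.sum_range_succ, ih, hχ.fourier_block_eq_sub]
    have h1 : q - 1 - (n : ℤ) + 1 = q - n := by ring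
    have h2 : q - 1 - (n : ℤ) = q - ((n + 1 : ℕ) : ℤ) := by push_cast; ring
    rw [h1, h2, sub_add_sub_cancel]

theorem symbol_mul_symbol (hχ : IsCutoff χ) {n N : ℤ} (h : n + 1 ≤ N) (ξ : Rd d) :
    symbol χ N ξ * symbol χ n ξ = symbol χ n ξ := by
  by_cases h0 : symbol χ n ξ = 0
  · rw [h0, mul_zero]
  · rw [hχ.symbol_eq_one, one_mul]
    have h1 : 2 * Real.pi * ‖ξ‖ ≤ 4 / 3 * (2 : ℝ) ^ n := by
      by_contra! hlt
      exact h0 (hχ.symbol_eq_zero hlt)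
    have h2 : (2 : ℝ) ^ (n + 1) ≤ 2 ^ N := zpow_le_zpow_right₀ one_le_two h
    rw [zpow_add_one₀ two_ne_zero] at h2
    have : (0 : ℝ) < 2 ^ n := by positivity
    linarith

theorem symbol_mul_symbol_annulus (hχ : IsCutoff χ) (l : ℤ) (ξ : Rd d) :
    symbol χ (l + 2) ξ * symbol (annulus χ) l ξ = symbol (annulus χ) l ξ := by
  rw [symbol_annulus, mul_sub, hχ.symbol_mul_symbol (by lia), hχ.symbol_mul_symbol (by lia)]

theorem smulLeft_fourier_lowFreq (hχ : IsCutoff χ) {n N : ℤ} (h : n + 1 ≤ N) (u : Distr d) :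
    TemperedDistribution.smulLeftCLM ℂ (fun ξ => (symbol χ n ξ : ℂ)) (𝓕 (lowFreq χ N u))
      = 𝓕 (lowFreq χ n u) := by
  rw [fourier_lowFreq, fourier_lowFreq, TemperedDistribution.smulLeftCLM_smulLeftCLM_apply
    (hχ.symbol_hasTemperateGrowth _) (hχ.symbol_hasTemperateGrowth _)]
  congr 2
  ext ξ
  rw [Pi.mul_apply, ← Complex.ofReal_mul, hχ.symbol_mul_symbol h]

/-- The cut-off `χ(2^{-l-2}D)` acts as the identity on the `l`-th block, which expresses the
spectral localization of the block. -/
theorem smulLeft_fourier_block (hχ : IsCutoff χ) (l : ℤ) (u : Distr d) :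
    TemperedDistribution.smulLeftCLM ℂ (fun ξ => (symbol χ (l + 2) ξ : ℂ)) (𝓕 (block χ l u))
      = 𝓕 (block χ l u) := by
  rw [fourier_block, TemperedDistribution.smulLeftCLM_smulLeftCLM_apply
    (hχ.symbol_annulus_hasTemperateGrowth _) (hχ.symbol_hasTemperateGrowth _)]
  congr 2
  ext ξ
  rw [Pi.mul_apply, ← Complex.ofReal_mul, mul_comm, hχ.symbol_mul_symbol_annulus]

/-- The support of the symbol of `χ(2^{-l-2}D)` lies in the ball of radius `16/3 · 2^l / (2π) < 2^l`. -/
theorem mem_closedBall_of_symbol_ne_zero (hχ : IsCutoff χ) {l : ℤ} {ξ : Rd d}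
    (h : symbol χ (l + 2) ξ ≠ 0) : ξ ∈ Metric.closedBall (0 : Rd d) ((2 : ℝ) ^ l) := by
  have h1 : 2 * Real.pi * ‖ξ‖ ≤ 4 / 3 * (2 : ℝ) ^ (l + 2) := by
    by_contra! hlt
    exact h (hχ.symbol_eq_zero hlt)
  rw [zpow_add₀ two_ne_zero] at h1
  have h3 : 6 * ‖ξ‖ ≤ 2 * Real.pi * ‖ξ‖ := by
    have := Real.pi_gt_three
    gcongr
    linarith
  have : (0 : ℝ) < 2 ^ l := by positivity
  simp only [Metric.mem_closedBall, dist_zero_right]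
  norm_num at h1
  linarith

/-- The Fourier transform of a dyadic block in `L²` is integrable (Bernstein's inequality from
`L²` to `L^∞`, read on the Fourier side). -/
theorem exists_fourier_block (hχ : IsCutoff χ) {u : Distr d} {l : ℤ}
    (h : lpNorm 2 (block χ l u) < ⊤) :
    ∃ f, IsFunction (𝓕 (block χ l u)) f ∧ MemLp f 1 volume ∧ eLpNorm f 1 volume ≤
      sqrtVolBall d * ((2 : ℝ≥0∞) ^ ((l : ℝ) * (d / 2)) * lpNorm 2 (block χ l u)) := by
  obtain ⟨f, hf, hf2⟩ := exists_fourier_of_lpNorm_two_lt_top h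
  have hsupp : ∀ᵐ ξ, ξ ∉ Metric.closedBall (0 : Rd d) ((2 : ℝ) ^ l) → ‖f ξ‖ₑ = 0 := by
    have h1 := hf.smulLeft (hχ.symbol_hasTemperateGrowth (l + 2))
    rw [hχ.smulLeft_fourier_block] at h1
    filter_upwards [hf.ae_eq h1] with ξ hξ hmem
    have h0 : symbol χ (l + 2) ξ = 0 := by
      by_contra hne
      exact hmem (hχ.mem_closedBall_of_symbol_ne_zero hne)
    rw [hξ, h0]
    simp
  have hle : eLpNorm f 1 volume ≤
      sqrtVolBall d * ((2 : ℝ≥0∞) ^ ((l : ℝ) * (d / 2)) * lpNorm 2 (block χ l u)) := by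
    rw [eLpNorm_one_eq_lintegral_enorm, lpNorm_two_eq hf hf2, ← mul_assoc,
      ← sqrt_volume_closedBall, eLpNorm_two_eq_l2norm]
    exact lintegral_le_rpow_volume_mul_l2norm hf2.1.enorm Metric.isClosed_closedBall.measurableSet
      hsupp
  refine ⟨f, hf, ⟨hf2.1, hle.trans_lt ?_⟩, hle⟩
  exact ENNReal.mul_lt_top (sqrtVolBall_lt_top d) (ENNReal.mul_lt_top
    (two_rpow_ne_top _).lt_top h)

end IsCutoff

/-- For `u ∈ 𝓢'_h` the low-frequency cut-offs vanish weakly at low frequencies. -/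
theorem InSh.tendsto_fourier_lowFreq {u : Distr d} (hu : InSh χ u) (ψ : 𝓢(Rd d, ℂ)) (q : ℤ) :
    Tendsto (fun N : ℕ => 𝓕 (lowFreq χ (q - N) u) ψ) atTop (𝓝 0) := by
  have hlim : Tendsto (fun N : ℕ => q - (N : ℤ)) atTop atBot :=
    tendsto_atBot_add_const_left _ q (tendsto_neg_atTop_atBot.comp tendsto_natCast_atTop_atTop)
  have h1 : Tendsto (fun N : ℕ => lpNorm ⊤ (lowFreq χ (q - N) u)) atTop (𝓝 0) :=
    Tendsto.comp (g := fun q : ℤ => lpNorm ⊤ (lowFreq χ q u)) hu hlim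
  have hfin : ∫⁻ x, ‖(𝓕 ψ) x‖ₑ ≠ ⊤ := (𝓕 ψ).integrable.2.ne
  have h2 : Tendsto (fun N : ℕ => lpNorm ⊤ (lowFreq χ (q - N) u) * ∫⁻ x, ‖(𝓕 ψ) x‖ₑ) atTop
      (𝓝 0) := by
    simpa using ENNReal.Tendsto.mul_const h1 (Or.inr hfin)
  rw [tendsto_zero_iff_enorm_tendsto_zero]
  refine tendsto_of_tendsto_of_tendsto_of_le_of_le' tendsto_const_nhds h2
    (Eventually.of_forall fun _ => zero_le) ?_
  filter_upwards [h1.eventually_lt_const ENNReal.zero_lt_top] with N hN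
  exact enorm_apply_le _ _ hN

/-- The Fourier transform of `Ṡ_n u` is the `L¹`-sum of those of the blocks `Δ̇_l u`, `l < n`. -/
theorem IsCutoff.exists_fourier_lowFreq (hχ : IsCutoff χ) {u : Distr d} (hu : InSh χ u)
    (h2 : ∀ l, lpNorm 2 (block χ l u) < ⊤) (n : ℤ)
    (hs : ∑' k : ℕ, (2 : ℝ≥0∞) ^ (((n - 1 - k : ℤ) : ℝ) * (d / 2)) *
      lpNorm 2 (block χ (n - 1 - k) u) ≠ ⊤) :
    ∃ f, IsFunction (𝓕 (lowFreq χ n u)) f ∧ Integrable f ∧ Measurable f := by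
  choose B hB hB1 hBle using fun l => hχ.exists_fourier_block (h2 l)
  let b : ℕ → Lp ℂ 1 (volume : Measure (Rd d)) := fun k => (hB1 (n - 1 - k)).toLp
  have hb : ∀ k, (b k : Distr d) = 𝓕 (block χ (n - 1 - k) u) := fun k =>
    (isFunction_toLp (hB1 (n - 1 - k))).distr_eq (hB (n - 1 - k))
  have hsum : Summable b := by
    refine Summable.of_enorm (ne_top_of_le_ne_top (ENNReal.mul_ne_top (sqrtVolBall_lt_top d).ne hs)
      ?_)
    rw [← ENNReal.tsum_mul_left]
    refine ENNReal.tsum_le_tsum fun k => ?_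
    rw [Lp.enorm_def, eLpNorm_congr_ae (hB1 (n - 1 - k)).coeFn_toLp]
    exact hBle _
  let Φ := MeasureTheory.Lp.toTemperedDistributionCLM ℂ (volume : Measure (Rd d)) 1
  have hH : 𝓕 (lowFreq χ n u) = ((∑' k, b k : Lp ℂ 1 (volume : Measure (Rd d))) : Distr d) := by
    have hlim := (Φ.continuous.tendsto _).comp hsum.hasSum.tendsto_sum_nat
    ext ψ
    have hlim' := PointwiseConvergenceCLM.tendsto_iff_forall_tendsto.1 hlim ψ
    have hpart : ∀ N : ℕ, Φ (∑ k ∈ Finset.range N, b k)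
        = 𝓕 (lowFreq χ n u) - 𝓕 (lowFreq χ (n - N) u) := fun N => by
      rw [map_sum, ← hχ.sum_fourier_block]
      exact Finset.sum_congr rfl fun k _ => hb k
    refine tendsto_nhds_unique (f := fun N : ℕ => Φ (∑ k ∈ Finset.range N, b k) ψ) ?_ hlim'
    simp only [hpart]
    simpa using (hu.tendsto_fourier_lowFreq ψ n).const_sub (𝓕 (lowFreq χ n u) ψ)
  refine ⟨(∑' k, b k : Lp ℂ 1 (volume : Measure (Rd d))), ?_, L1.integrable_coeFn _,
    (Lp.stronglyMeasurable _).measurable⟩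
  rw [hH]
  exact isFunction_toTemperedDistribution _

/-- A distribution in `𝓢'_h` whose blocks are summable at low frequencies in the critical space
`Ḃ^{d/2}_{2,1}` has a Fourier transform that is a function integrable on bounded sets. -/
theorem IsCutoff.exists_isSpectrum (hχ : IsCutoff χ) {u : Distr d} (hu : InSh χ u)
    (h2 : ∀ l, lpNorm 2 (block χ l u) < ⊤)
    (hs : ∀ n : ℤ, ∑' k : ℕ, (2 : ℝ≥0∞) ^ (((n - 1 - k : ℤ) : ℝ) * (d / 2)) *
      lpNorm 2 (block χ (n - 1 - k) u) ≠ ⊤) :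
    ∃ U, IsSpectrum χ u U := by
  choose H hH hint hmeas using fun n => hχ.exists_fourier_lowFreq hu h2 n (hs n)
  have hfind : ∀ ξ, ∃ m : ℕ, symbol χ m ξ = 1 := fun ξ =>
    (tendsto_natCast_atTop_atTop.eventually (hχ.eventually_symbol_eq_one ξ)).exists
  classical
  -- `U` is glued from the low-frequency pieces: at `ξ` take the first one whose cut-off is `1`.
  let U : Rd d → ℂ := fun ξ => H (Nat.find (hfind ξ)) ξ
  have hU : Measurable U := Measurable.find (fun m : ℕ => hmeas (m : ℤ))
    (fun m => (hχ.symbol_continuous m).measurable (measurableSet_singleton 1)) hfind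
  have hcomp : ∀ᵐ ξ, ∀ n N : ℤ, n + 1 ≤ N → (symbol χ n ξ : ℂ) * H N ξ = H n ξ := by
    simp only [ae_all_iff]
    intro n N hnN
    have h1 := (hH N).smulLeft (hχ.symbol_hasTemperateGrowth n)
    rw [hχ.smulLeft_fourier_lowFreq hnN] at h1
    exact h1.ae_eq (hH n)
  have hUn : ∀ n : ℤ, H n =ᵐ[volume] fun ξ => (symbol χ n ξ : ℂ) * U ξ := fun n => by
    filter_upwards [hcomp] with ξ hξ
    have hm := Nat.find_spec (hfind ξ)
    have h1 : U ξ = H (max n (Nat.find (hfind ξ)) + 1) ξ := by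
      have := hξ (Nat.find (hfind ξ)) (max n (Nat.find (hfind ξ)) + 1) (by lia)
      rw [hm, Complex.ofReal_one, one_mul] at this
      exact this.symm
    rw [h1, hξ n _ (by lia)]
  exact ⟨U, hU, fun n => (hint n).congr (hUn n), fun n => (hH n).congr_ae (hUn n)⟩

theorem IsSpectrum.isFunction_block (hχ : IsCutoff χ) {u : Distr d} {U : Rd d → ℂ}
    (hU : IsSpectrum χ u U) (l : ℤ) :
    IsFunction (𝓕 (block χ l u)) fun ξ => (symbol (annulus χ) l ξ : ℂ) * U ξ := by
  rw [hχ.fourier_block_eq_sub]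
  convert (hU.isFunction (l + 1)).sub (hU.isFunction l) using 2 with ξ
  rw [symbol_annulus]
  push_cast
  ring

theorem IsSpectrum.lpNorm_block (hχ : IsCutoff χ) {u : Distr d} {U : Rd d → ℂ}
    (hU : IsSpectrum χ u U) {l : ℤ} (h : lpNorm 2 (block χ l u) < ⊤) :
    l2norm (fun ξ => ‖(symbol (annulus χ) l ξ : ℂ) * U ξ‖ₑ) = lpNorm 2 (block χ l u) := by
  obtain ⟨f, hf, hf2⟩ := exists_fourier_of_lpNorm_two_lt_top h
  have hfU := hf.ae_eq (hU.isFunction_block hχ l)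
  rw [← eLpNorm_two_eq_l2norm, lpNorm_two_eq (hU.isFunction_block hχ l) (hf2.ae_eq hfU)]

/-! ### Convolution of nonnegative functions supported in dyadic annuli -/

/-- The convolution of two nonnegative extended functions. -/
def lconv (F G : Rd d → ℝ≥0∞) (ξ : Rd d) : ℝ≥0∞ := ∫⁻ η, F η * G (ξ - η)

theorem measurable_lconv {F G : Rd d → ℝ≥0∞} (hF : Measurable F) (hG : Measurable G) :
    Measurable (lconv F G) := by
  unfold lconv
  exact Measurable.lintegral_prod_right' (f := fun p : Rd d × Rd d => F p.2 * G (p.1 - p.2))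
    (by fun_prop)

theorem lconv_comm (F G : Rd d → ℝ≥0∞) : lconv F G = lconv G F := by
  ext ξ
  unfold lconv
  rw [← lintegral_sub_left_eq_self _ ξ]
  simp [mul_comm]

theorem l2norm_comp_sub_left (G : Rd d → ℝ≥0∞) (ξ : Rd d) :
    l2norm (fun η => G (ξ - η)) = l2norm G := by
  unfold l2norm
  rw [lintegral_sub_left_eq_self (fun η => G η ^ (2 : ℝ)) ξ]

theorem lconv_le_l2norm_mul_l2norm {F G : Rd d → ℝ≥0∞} (hF : Measurable F) (hG : Measurable G)
    (ξ : Rd d) : lconv F G ξ ≤ l2norm F * l2norm G := by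
  rw [← l2norm_comp_sub_left G ξ]
  exact ENNReal.lintegral_mul_le_Lp_mul_Lq volume Real.HolderConjugate.two_two hF.aemeasurable
    (hG.comp (measurable_const.sub measurable_id)).aemeasurable

/-- Young's inequality `L¹ * L² → L²`, with the `L¹` norm estimated by the `L²` norm on the support
of the first factor. -/
theorem l2norm_lconv_le_of_left {F G : Rd d → ℝ≥0∞} (hF : Measurable F) (hG : Measurable G)
    {A : Set (Rd d)} (hA : MeasurableSet A) (h : ∀ ξ ∉ A, F ξ = 0) :
    l2norm (lconv F G) ≤ volume A ^ (1 / 2 : ℝ) * (l2norm F * l2norm G) := by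
  have h1 : ∀ ξ, lconv F G ξ ^ (2 : ℝ) ≤
      volume A * ∫⁻ η, F η ^ (2 : ℝ) * G (ξ - η) ^ (2 : ℝ) := fun ξ => by
    have := lintegral_le_rpow_volume_mul_l2norm (F := fun η => F η * G (ξ - η))
      (by fun_prop) hA (Eventually.of_forall fun η hη => by simp [h η hη])
    refine (ENNReal.rpow_le_rpow this (by norm_num : (0 : ℝ) ≤ 2)).trans (le_of_eq ?_)
    unfold l2norm
    rw [← ENNReal.mul_rpow_of_nonneg _ _ (by norm_num), ← ENNReal.rpow_mul]
    simp [mul_pow]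
  have h2 : ∫⁻ ξ, ∫⁻ η, F η ^ (2 : ℝ) * G (ξ - η) ^ (2 : ℝ)
      = (∫⁻ η, F η ^ (2 : ℝ)) * ∫⁻ η, G η ^ (2 : ℝ) := by
    rw [lintegral_lintegral_swap (by fun_prop)]
    have : ∀ η, ∫⁻ ξ, F η ^ (2 : ℝ) * G (ξ - η) ^ (2 : ℝ)
        = F η ^ (2 : ℝ) * ∫⁻ ξ, G ξ ^ (2 : ℝ) := fun η => by
      rw [lintegral_const_mul _ (by fun_prop),
        lintegral_sub_right_eq_self (fun ξ => G ξ ^ (2 : ℝ)) η]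
    simp only [this]
    rw [lintegral_mul_const _ (by fun_prop)]
  unfold l2norm
  rw [← ENNReal.mul_rpow_of_nonneg _ _ (by norm_num), ← ENNReal.mul_rpow_of_nonneg _ _ (by norm_num),
    ← h2, ← lintegral_const_mul _ (Measurable.lintegral_prod_right'
      (f := fun p : Rd d × Rd d => F p.2 ^ (2 : ℝ) * G (p.1 - p.2) ^ (2 : ℝ)) (by fun_prop))]
  exact ENNReal.rpow_le_rpow (lintegral_mono h1) (by norm_num)

theorem l2norm_indicator_le {H : Rd d → ℝ≥0∞} {D : Set (Rd d)} (hD : MeasurableSet D)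
    {c : ℝ≥0∞} (h : ∀ ξ, H ξ ≤ c) : l2norm (D.indicator H) ≤ volume D ^ (1 / 2 : ℝ) * c := by
  unfold l2norm
  calc (∫⁻ ξ, D.indicator H ξ ^ (2 : ℝ)) ^ (1 / 2 : ℝ)
      ≤ (∫⁻ ξ, D.indicator (fun _ => c ^ (2 : ℝ)) ξ) ^ (1 / 2 : ℝ) := by
        gcongr with ξ
        by_cases hm : ξ ∈ D
        · simp only [hm, Set.indicator_of_mem]
          gcongr
          exact h ξ
        · simp [hm]
    _ = volume D ^ (1 / 2 : ℝ) * c := by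
        rw [lintegral_indicator_const hD, ENNReal.mul_rpow_of_nonneg _ _ (by norm_num),
          ← ENNReal.rpow_mul, mul_comm]
        simp

theorem isClosed_dyadicAnnulus (d : ℕ) (l : ℤ) : IsClosed (dyadicAnnulus d l) :=
  IsClosed.inter
    (isClosed_le continuous_const (continuous_const.mul continuous_norm))
    (isClosed_le (continuous_const.mul continuous_norm) continuous_const)

theorem dyadicAnnulus_subset (d : ℕ) (l : ℤ) :
    dyadicAnnulus d l ⊆ Metric.closedBall 0 ((2 : ℝ) ^ l) := fun ξ hξ => by
  have h3 : 6 * ‖ξ‖ ≤ 2 * Real.pi * ‖ξ‖ := by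
    have := Real.pi_gt_three
    gcongr
    linarith
  have : (0 : ℝ) < 2 ^ l := by positivity
  simp only [Metric.mem_closedBall, dist_zero_right]
  linarith [hξ.2]

theorem sqrt_volume_dyadicAnnulus_le (d : ℕ) (l : ℤ) :
    volume (dyadicAnnulus d l) ^ (1 / 2 : ℝ)
      ≤ sqrtVolBall d * (2 : ℝ≥0∞) ^ ((l : ℝ) * (d / 2)) := by
  rw [← sqrt_volume_closedBall]
  exact ENNReal.rpow_le_rpow (measure_mono (dyadicAnnulus_subset d l)) (by norm_num)

/-- The trilinear estimate behind the product laws: each of the three localizations allows to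
trade an `L²` norm for an `L¹` or `L^∞` norm, so that the smallest frequency pays. -/
theorem l2norm_indicator_lconv_le {F G : Rd d → ℝ≥0∞} (hF : Measurable F) (hG : Measurable G)
    {j k : ℤ} (hFj : ∀ ξ ∉ dyadicAnnulus d j, F ξ = 0) (hGk : ∀ ξ ∉ dyadicAnnulus d k, G ξ = 0)
    (l : ℤ) :
    l2norm ((dyadicAnnulus d l).indicator (lconv F G))
      ≤ sqrtVolBall d * (2 : ℝ≥0∞) ^ (((min (min j k) l : ℤ) : ℝ) * (d / 2)) *
        (l2norm F * l2norm G) := by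
  have hm := fun l => (isClosed_dyadicAnnulus d l).measurableSet
  have hle : l2norm ((dyadicAnnulus d l).indicator (lconv F G)) ≤ l2norm (lconv F G) :=
    l2norm_mono (Eventually.of_forall fun ξ => Set.indicator_le_self _ _ ξ)
  have hj : l2norm ((dyadicAnnulus d l).indicator (lconv F G))
      ≤ sqrtVolBall d * (2 : ℝ≥0∞) ^ ((j : ℝ) * (d / 2)) * (l2norm F * l2norm G) :=
    (hle.trans (l2norm_lconv_le_of_left hF hG (hm j) hFj)).trans
      (by gcongr; exact sqrt_volume_dyadicAnnulus_le d j)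
  have hk : l2norm ((dyadicAnnulus d l).indicator (lconv F G))
      ≤ sqrtVolBall d * (2 : ℝ≥0∞) ^ ((k : ℝ) * (d / 2)) * (l2norm F * l2norm G) := by
    rw [mul_comm (l2norm F)]
    refine (hle.trans ?_).trans (mul_le_mul_left (sqrt_volume_dyadicAnnulus_le d k) _)
    rw [lconv_comm]
    exact l2norm_lconv_le_of_left hG hF (hm k) hGk
  have hl : l2norm ((dyadicAnnulus d l).indicator (lconv F G))
      ≤ sqrtVolBall d * (2 : ℝ≥0∞) ^ ((l : ℝ) * (d / 2)) * (l2norm F * l2norm G) :=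
    (l2norm_indicator_le (hm l) (lconv_le_l2norm_mul_l2norm hF hG)).trans
      (by gcongr; exact sqrt_volume_dyadicAnnulus_le d l)
  rcases min_choice (min j k) l with h | h <;> rw [h]
  · rcases min_choice j k with h' | h' <;> rw [h']
    · exact hj
    · exact hk
  · exact hl

theorem le_max_add_two {j k l : ℤ}
    (h : 3 / 4 * (2 : ℝ) ^ l ≤ 8 / 3 * 2 ^ j + 8 / 3 * 2 ^ k) : l ≤ max j k + 2 := by
  by_contra! hlt
  have h1 : (2 : ℝ) ^ (max j k + 3) ≤ 2 ^ l := zpow_le_zpow_right₀ one_le_two (by lia)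
  have h2 : (2 : ℝ) ^ j ≤ 2 ^ max j k := zpow_le_zpow_right₀ one_le_two (le_max_left _ _)
  have h3 : (2 : ℝ) ^ k ≤ 2 ^ max j k := zpow_le_zpow_right₀ one_le_two (le_max_right _ _)
  rw [zpow_add₀ two_ne_zero] at h1
  have : (0 : ℝ) < 2 ^ max j k := by positivity
  norm_num at h1
  linarith

/-- Frequencies of a sum: the largest of the three dyadic frequencies is comparable to the second
largest. -/
theorem dyadic_triangle {j k l : ℤ} {ξ η : Rd d} (hη : η ∈ dyadicAnnulus d j)
    (hζ : ξ - η ∈ dyadicAnnulus d k) (hξ : ξ ∈ dyadicAnnulus d l) :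
    l ≤ max j k + 2 ∧ j ≤ max k l + 2 ∧ k ≤ max j l + 2 := by
  have hpi : 0 ≤ 2 * Real.pi := by positivity
  have h1 : ‖ξ‖ ≤ ‖η‖ + ‖ξ - η‖ := by simpa using norm_add_le η (ξ - η)
  have h2 : ‖η‖ ≤ ‖ξ - η‖ + ‖ξ‖ := by
    simpa [norm_sub_rev] using norm_add_le (η - ξ) ξ
  have h3 : ‖ξ - η‖ ≤ ‖η‖ + ‖ξ‖ := (norm_sub_le ξ η).trans_eq (add_comm _ _)
  have h1' := mul_le_mul_of_nonneg_left h1 hpi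
  have h2' := mul_le_mul_of_nonneg_left h2 hpi
  have h3' := mul_le_mul_of_nonneg_left h3 hpi
  refine ⟨le_max_add_two ?_, le_max_add_two ?_, le_max_add_two ?_⟩
  · linarith [hη.2, hζ.2, hξ.1]
  · linarith [hη.1, hζ.2, hξ.2]
  · linarith [hη.2, hζ.1, hξ.2]

/-- The balance of exponents in the product law `Ḃ^{s₁}_{2,1} × Ḃ^{s₂}_{2,1} → Ḃ^{s₁+s₂-h}_{2,1}`
with `s₁, s₂ ≤ h` and `s₁ + s₂ > 0`. The last term on the right makes the sum over `l`
converge. -/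
theorem dyadic_exponent_le {j k l : ℤ} (hl : l ≤ max j k + 2) (hj : j ≤ max k l + 2)
    (hk : k ≤ max j l + 2) {s₁ s₂ h : ℝ} (h0 : 0 ≤ h) (h1 : s₁ ≤ h) (h2 : s₂ ≤ h)
    (hpos : 0 < s₁ + s₂) :
    (l : ℝ) * (s₁ + s₂ - h) + ((min (min j k) l : ℤ) : ℝ) * h ≤
      (j : ℝ) * s₁ + k * s₂ + (4 * (s₁ + s₂) + 2 * |s₁| + 2 * |s₂| + 2 * |s₁ + s₂ - h|)
        + -(s₁ + s₂) * ((|l - max j k| : ℤ) : ℝ) := by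
  have hs1 := abs_nonneg s₁
  have hs2 := abs_nonneg s₂
  have hs3 := abs_nonneg (s₁ + s₂ - h)
  have key : ∀ (x : ℝ) (n : ℤ), |n| ≤ 2 → (n : ℝ) * x ≤ 2 * |x| := fun x n hn => by
    have : |(n : ℝ)| ≤ 2 := by exact_mod_cast hn
    calc (n : ℝ) * x ≤ |(n : ℝ) * x| := le_abs_self _
      _ = |(n : ℝ)| * |x| := abs_mul _ _
      _ ≤ 2 * |x| := by gcongr
  have hmin : ∀ m : ℤ, min (min j k) l ≤ m → ((min (min j k) l : ℤ) : ℝ) * h ≤ m * h := fun m hm =>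
    mul_le_mul_of_nonneg_right (by exact_mod_cast hm) h0
  rcases le_or_gt |j - k| 2 with hjk | hjk
  · -- Comparable input frequencies: the output frequency is the smallest one up to a constant.
    have hm := hmin l (min_le_right _ _)
    have hA : ((|l - max j k| : ℤ) : ℝ) ≤ (max j k : ℤ) - l + 4 := by
      have : |l - max j k| ≤ max j k - l + 4 := by
        rw [abs_le]; constructor <;> lia
      exact_mod_cast this
    have hA' := mul_le_mul_of_nonneg_left hA hpos.le
    have hB := key s₁ (max j k - j) (by rw [abs_le] at hjk ⊢; constructor <;> lia)
    have hC := key s₂ (max j k - k) (by rw [abs_le] at hjk ⊢; constructor <;> lia)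
    push_cast at hA' hB hC hm ⊢
    linarith
  · -- Separated input frequencies: the output frequency is comparable to the larger one.
    rcases lt_or_ge j k with hlt | hge
    · have hjk' : j + 3 ≤ k := by rw [lt_abs] at hjk; lia
      have hmax : max j k = k := by lia
      have hlk : |l - k| ≤ 2 := by rw [abs_le]; constructor <;> lia
      have hm := hmin j (by lia)
      have hB := key (s₁ + s₂ - h) (l - k) hlk
      have hlk' : ((|l - k| : ℤ) : ℝ) ≤ 2 := by exact_mod_cast hlk
      have hA' := mul_le_mul_of_nonneg_left hlk' hpos.le
      have hC : 0 ≤ ((k : ℝ) - j) * (h - s₁) :=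
        mul_nonneg (by rw [sub_nonneg]; exact_mod_cast hlt.le) (by linarith)
      rw [hmax]
      push_cast at hA' hB hm ⊢
      linarith
    · have hjk' : k + 3 ≤ j := by rw [lt_abs] at hjk; lia
      have hmax : max j k = j := by lia
      have hlk : |l - j| ≤ 2 := by rw [abs_le]; constructor <;> lia
      have hm := hmin k (by lia)
      have hB := key (s₁ + s₂ - h) (l - j) hlk
      have hlk' : ((|l - j| : ℤ) : ℝ) ≤ 2 := by exact_mod_cast hlk
      have hA' := mul_le_mul_of_nonneg_left hlk' hpos.le
      have hC : 0 ≤ ((j : ℝ) - k) * (h - s₂) :=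
        mul_nonneg (by rw [sub_nonneg]; exact_mod_cast hge) (by linarith)
      rw [hmax]
      push_cast at hA' hB hm ⊢
      linarith

theorem tsum_two_rpow_abs_lt_top {c : ℝ} (hc : 0 < c) :
    ∑' l : ℤ, (2 : ℝ≥0∞) ^ (-c * ((|l| : ℤ) : ℝ)) < ⊤ := by
  have hr : (2 : ℝ≥0∞) ^ (-c) < 1 := by
    rw [ENNReal.rpow_neg, ENNReal.inv_lt_one]
    exact ENNReal.one_lt_rpow (by norm_num) hc
  have hgeo : ∑' n : ℕ, ((2 : ℝ≥0∞) ^ (-c)) ^ n < ⊤ := by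
    rw [ENNReal.tsum_geometric, ENNReal.inv_lt_top, tsub_pos_iff_lt]
    exact hr
  have hle : ∑' l : ℤ, (2 : ℝ≥0∞) ^ (-c * ((|l| : ℤ) : ℝ))
      ≤ ∑' n : ℕ, ((2 : ℝ≥0∞) ^ (-c)) ^ n + ∑' n : ℕ, ((2 : ℝ≥0∞) ^ (-c)) ^ n := by
    rw [tsum_of_nat_of_neg_add_one ENNReal.summable ENNReal.summable]
    simp only [← ENNReal.rpow_mul_natCast]
    refine add_le_add
      (ENNReal.tsum_le_tsum fun n => ENNReal.rpow_le_rpow_of_exponent_le one_le_two ?_)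
      (ENNReal.tsum_le_tsum fun n => ENNReal.rpow_le_rpow_of_exponent_le one_le_two ?_)
    · simp
    · rw [abs_neg, abs_of_nonneg (by positivity)]
      push_cast
      linarith
  exact hle.trans_lt (ENNReal.add_lt_top.2 ⟨hgeo, hgeo⟩)

/-- The product law for two functions whose frequencies are localized in single dyadic annuli. -/
theorem exists_tsum_l2norm_indicator_lconv_le (d : ℕ) {s₁ s₂ : ℝ} (h1 : s₁ ≤ (d : ℝ) / 2)
    (h2 : s₂ ≤ (d : ℝ) / 2) (hpos : 0 < s₁ + s₂) :
    ∃ C : ℝ≥0∞, C < ⊤ ∧ ∀ (j k : ℤ) (F G : Rd d → ℝ≥0∞), Measurable F → Measurable G →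
      (∀ ξ ∉ dyadicAnnulus d j, F ξ = 0) → (∀ ξ ∉ dyadicAnnulus d k, G ξ = 0) →
      ∑' l : ℤ, (2 : ℝ≥0∞) ^ ((l : ℝ) * (s₁ + s₂ - d / 2)) *
          l2norm ((dyadicAnnulus d l).indicator (lconv F G))
        ≤ C * ((2 : ℝ≥0∞) ^ ((j : ℝ) * s₁) * l2norm F * (2 ^ ((k : ℝ) * s₂) * l2norm G)) := by
  set D : ℝ := 4 * (s₁ + s₂) + 2 * |s₁| + 2 * |s₂| + 2 * |s₁ + s₂ - d / 2|
  refine ⟨sqrtVolBall d * 2 ^ D * ∑' l : ℤ, (2 : ℝ≥0∞) ^ (-(s₁ + s₂) * ((|l| : ℤ) : ℝ)),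
    ENNReal.mul_lt_top (ENNReal.mul_lt_top (sqrtVolBall_lt_top d) (two_rpow_ne_top D).lt_top)
      (tsum_two_rpow_abs_lt_top hpos), fun j k F G hF hG hFj hGk => ?_⟩
  have hterm : ∀ l : ℤ, (2 : ℝ≥0∞) ^ ((l : ℝ) * (s₁ + s₂ - d / 2)) *
      l2norm ((dyadicAnnulus d l).indicator (lconv F G)) ≤
      sqrtVolBall d * 2 ^ D * (2 : ℝ≥0∞) ^ (-(s₁ + s₂) * ((|l - max j k| : ℤ) : ℝ)) *
        ((2 : ℝ≥0∞) ^ ((j : ℝ) * s₁) * l2norm F * (2 ^ ((k : ℝ) * s₂) * l2norm G)) := by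
    intro l
    by_cases hz : ∃ ξ ∈ dyadicAnnulus d l, lconv F G ξ ≠ 0
    · obtain ⟨ξ, hξ, hne⟩ := hz
      obtain ⟨η, hη⟩ : ∃ η, F η * G (ξ - η) ≠ 0 := by
        by_contra! hall
        exact hne (by simp [lconv, hall])
      obtain ⟨hl, hj, hk⟩ := dyadic_triangle
        (not_imp_comm.1 (hFj η) (left_ne_zero_of_mul hη))
        (not_imp_comm.1 (hGk (ξ - η)) (right_ne_zero_of_mul hη)) hξ
      have hexp := dyadic_exponent_le hl hj hk (by positivity : (0 : ℝ) ≤ d / 2) h1 h2 hpos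
      calc _ ≤ (2 : ℝ≥0∞) ^ ((l : ℝ) * (s₁ + s₂ - d / 2)) *
            (sqrtVolBall d * (2 : ℝ≥0∞) ^ (((min (min j k) l : ℤ) : ℝ) * (d / 2)) *
              (l2norm F * l2norm G)) := by
            gcongr
            exact l2norm_indicator_lconv_le hF hG hFj hGk l
        _ = sqrtVolBall d * (2 : ℝ≥0∞) ^ ((l : ℝ) * (s₁ + s₂ - d / 2) +
              ((min (min j k) l : ℤ) : ℝ) * (d / 2)) * (l2norm F * l2norm G) := by
            rw [two_rpow_add]
            ring
        _ ≤ sqrtVolBall d * (2 : ℝ≥0∞) ^ ((j : ℝ) * s₁ + k * s₂ + D +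
              -(s₁ + s₂) * ((|l - max j k| : ℤ) : ℝ)) * (l2norm F * l2norm G) := by
            gcongr
            exact one_le_two
        _ = _ := by
            simp only [two_rpow_add]
            ring
    · -- Outside the range of admissible `l` the convolution vanishes on the annulus.
      push Not at hz
      have : (dyadicAnnulus d l).indicator (lconv F G) = fun _ => 0 := by
        ext ξ
        by_cases hξ : ξ ∈ dyadicAnnulus d l
        · simp [hξ, hz ξ hξ]
        · simp [hξ]
      rw [this]
      simp [l2norm]
  refine (ENNReal.tsum_le_tsum hterm).trans (le_of_eq ?_)
  rw [ENNReal.tsum_mul_right, ENNReal.tsum_mul_left]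
  congr 2
  exact (Equiv.subRight (max j k)).tsum_eq fun l : ℤ => (2 : ℝ≥0∞) ^ (-(s₁ + s₂) * ((|l| : ℤ) : ℝ))

/-- Minkowski's inequality for countable sums. -/
theorem l2norm_tsum_le {ι : Type*} [Countable ι] {f : ι → Rd d → ℝ≥0∞}
    (hf : ∀ i, Measurable (f i)) :
    l2norm (fun ξ => ∑' i, f i ξ) ≤ ∑' i, l2norm (f i) := by
  have hfin : ∀ s : Finset ι, l2norm (fun ξ => ∑ i ∈ s, f i ξ) ≤ ∑ i ∈ s, l2norm (f i) := by
    classical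
    intro s
    induction s using Finset.induction_on with
    | empty => simp [l2norm]
    | insert i s hi ih =>
      simp only [Finset.sum_insert hi]
      refine le_trans ?_ (add_le_add_right ih _)
      exact ENNReal.lintegral_Lp_add_le (hf i).aemeasurable
        (Finset.measurable_fun_sum s fun i _ => hf i).aemeasurable one_le_two
  have hsup : l2norm (fun ξ => ∑' i, f i ξ)
      = ⨆ s : Finset ι, l2norm (fun ξ => ∑ i ∈ s, f i ξ) := by
    unfold l2norm
    have h2 : ∀ ξ, (∑' i, f i ξ) ^ (2 : ℝ) = ⨆ s : Finset ι, (∑ i ∈ s, f i ξ) ^ (2 : ℝ) :=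
      fun ξ => by
        rw [ENNReal.tsum_eq_iSup_sum]
        exact (ENNReal.orderIsoRpow 2 two_pos).map_iSup _
    simp only [h2]
    rw [lintegral_iSup_directed]
    · exact (ENNReal.orderIsoRpow (1 / 2) (by norm_num)).map_iSup _
    · exact fun s => ((Finset.measurable_fun_sum s fun i _ => hf i).pow_const _).aemeasurable
    · refine directed_of_isDirected_le fun s t hst ξ => ?_
      dsimp only
      gcongr
  rw [hsup]
  exact iSup_le fun s => (hfin s).trans (ENNReal.sum_le_tsum s)

/-! ### Summation over the dyadic blocks -/

theorem ae_ne_of_pos (hd : 0 < d) (x : Rd d) : ∀ᵐ ξ : Rd d, ξ ≠ x := by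
  have : Nonempty (Fin d) := ⟨⟨0, hd⟩⟩
  exact compl_mem_ae_iff.2 (measure_singleton x)

theorem IsCutoff.measurable_symbol_annulus_mul (hχ : IsCutoff χ) {U : Rd d → ℂ}
    (hU : Measurable U) (l : ℤ) :
    Measurable fun ξ => ‖(symbol (annulus χ) l ξ : ℂ) * U ξ‖ₑ :=
  ((Complex.measurable_ofReal.comp (hχ.symbol_annulus_continuous l).measurable).mul hU).enorm

theorem IsCutoff.symbol_annulus_mul_eq_zero (hχ : IsCutoff χ) (U : Rd d → ℂ) (l : ℤ) :
    ∀ ξ ∉ dyadicAnnulus d l, ‖(symbol (annulus χ) l ξ : ℂ) * U ξ‖ₑ = 0 := fun ξ hξ => by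
  have : symbol (annulus χ) l ξ = 0 := by
    by_contra hne
    exact hξ (hχ.mem_dyadicAnnulus hne)
  simp [this]

/-- The convolution of two functions is dominated by the sum of the convolutions of their dyadic
blocks. -/
theorem IsCutoff.lconv_le_tsum (hχ : IsCutoff χ) (hd : 0 < d) {U V : Rd d → ℂ}
    (hU : Measurable U) (hV : Measurable V) (ξ : Rd d) :
    lconv (fun η => ‖U η‖ₑ) (fun η => ‖V η‖ₑ) ξ ≤
      ∑' p : ℤ × ℤ, lconv (fun η => ‖(symbol (annulus χ) p.1 η : ℂ) * U η‖ₑ)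
        (fun η => ‖(symbol (annulus χ) p.2 η : ℂ) * V η‖ₑ) ξ := by
  have hmeas : ∀ p : ℤ × ℤ, AEMeasurable (fun η => ‖(symbol (annulus χ) p.1 η : ℂ) * U η‖ₑ *
      ‖(symbol (annulus χ) p.2 (ξ - η) : ℂ) * V (ξ - η)‖ₑ) volume := fun p =>
    Measurable.aemeasurable <| (hχ.measurable_symbol_annulus_mul hU p.1).mul
      (Measurable.comp (g := fun η => ‖(symbol (annulus χ) p.2 η : ℂ) * V η‖ₑ)
        (hχ.measurable_symbol_annulus_mul hV p.2) (measurable_const.sub measurable_id))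
  unfold lconv
  rw [← lintegral_tsum hmeas]
  refine lintegral_mono_ae ?_
  filter_upwards [ae_ne_of_pos hd 0, ae_ne_of_pos hd ξ] with η h0 h1
  rw [ENNReal.tsum_prod (f := fun j k => ‖(symbol (annulus χ) j η : ℂ) * U η‖ₑ *
    ‖(symbol (annulus χ) k (ξ - η) : ℂ) * V (ξ - η)‖ₑ)]
  simp only [ENNReal.tsum_mul_left, ENNReal.tsum_mul_right]
  exact mul_le_mul' (hχ.enorm_le_tsum_symbol_annulus h0 _)
    (hχ.enorm_le_tsum_symbol_annulus (sub_ne_zero.2 h1.symm) _)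

/-- Bilinear estimates for single dyadic blocks sum up to bilinear estimates with respect to the
corresponding weighted sums over all blocks. -/
theorem IsCutoff.tsum_l2norm_lconv_le (hχ : IsCutoff χ) (hd : 0 < d) {U V : Rd d → ℂ}
    (hU : Measurable U) (hV : Measurable V) {σ : ℝ} {K : ℝ≥0∞} {p q : ℤ → ℝ≥0∞}
    (hK : ∀ (j k : ℤ) (F G : Rd d → ℝ≥0∞), Measurable F → Measurable G →
      (∀ ξ ∉ dyadicAnnulus d j, F ξ = 0) → (∀ ξ ∉ dyadicAnnulus d k, G ξ = 0) →
      ∑' l : ℤ, (2 : ℝ≥0∞) ^ ((l : ℝ) * σ) *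
          l2norm ((dyadicAnnulus d l).indicator (lconv F G))
        ≤ K * (p j * l2norm F * (q k * l2norm G))) :
    ∑' l : ℤ, (2 : ℝ≥0∞) ^ ((l : ℝ) * σ) * l2norm ((dyadicAnnulus d l).indicator
        (lconv (fun η => ‖U η‖ₑ) (fun η => ‖V η‖ₑ))) ≤
      K * (∑' j : ℤ, p j * l2norm fun η => ‖(symbol (annulus χ) j η : ℂ) * U η‖ₑ) *
        ∑' k : ℤ, q k * l2norm fun η => ‖(symbol (annulus χ) k η : ℂ) * V η‖ₑ := by
  set F : ℤ → Rd d → ℝ≥0∞ := fun j η => ‖(symbol (annulus χ) j η : ℂ) * U η‖ₑ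
  set G : ℤ → Rd d → ℝ≥0∞ := fun k η => ‖(symbol (annulus χ) k η : ℂ) * V η‖ₑ
  have hF := hχ.measurable_symbol_annulus_mul hU
  have hG := hχ.measurable_symbol_annulus_mul hV
  have hl : ∀ l : ℤ, l2norm ((dyadicAnnulus d l).indicator
      (lconv (fun η => ‖U η‖ₑ) (fun η => ‖V η‖ₑ))) ≤
      ∑' r : ℤ × ℤ, l2norm ((dyadicAnnulus d l).indicator (lconv (F r.1) (G r.2))) := by
    intro l
    refine le_trans (l2norm_mono (Eventually.of_forall fun ξ => ?_)) (l2norm_tsum_le fun r =>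
      (measurable_lconv (hF r.1) (hG r.2)).indicator (isClosed_dyadicAnnulus d l).measurableSet)
    by_cases hξ : ξ ∈ dyadicAnnulus d l
    · simp only [hξ, Set.indicator_of_mem]
      exact hχ.lconv_le_tsum hd hU hV ξ
    · simp [hξ]
  calc _ ≤ ∑' l : ℤ, ∑' r : ℤ × ℤ, (2 : ℝ≥0∞) ^ ((l : ℝ) * σ) *
          l2norm ((dyadicAnnulus d l).indicator (lconv (F r.1) (G r.2))) := by
        refine ENNReal.tsum_le_tsum fun l => ?_
        rw [ENNReal.tsum_mul_left]
        gcongr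
        exact hl l
    _ = ∑' r : ℤ × ℤ, ∑' l : ℤ, (2 : ℝ≥0∞) ^ ((l : ℝ) * σ) *
          l2norm ((dyadicAnnulus d l).indicator (lconv (F r.1) (G r.2))) := ENNReal.tsum_comm
    _ ≤ ∑' r : ℤ × ℤ, K * (p r.1 * l2norm (F r.1) * (q r.2 * l2norm (G r.2))) :=
        ENNReal.tsum_le_tsum fun r => hK r.1 r.2 _ _ (hF r.1) (hG r.2)
          (hχ.symbol_annulus_mul_eq_zero U r.1) (hχ.symbol_annulus_mul_eq_zero V r.2)
    _ = _ := by
        rw [ENNReal.tsum_mul_left, ENNReal.tsum_prod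
          (f := fun j k => p j * l2norm (F j) * (q k * l2norm (G k)))]
        simp only [ENNReal.tsum_mul_left, ENNReal.tsum_mul_right]
        rw [mul_assoc]

/-- On the annulus of index `l` the weight `(1 + |ξ|²)^{-h/2}` is at most a multiple of `2^{-lh}`;
the factor `2^{4h}` comes from `2^l ≤ 16 |ξ|`. -/
theorem ofReal_one_add_sq_rpow_le {l : ℤ} {ξ : Rd d} (hξ : ξ ∈ dyadicAnnulus d l) {h : ℝ}
    (h0 : 0 ≤ h) :
    ENNReal.ofReal ((1 + ‖ξ‖ ^ 2) ^ (-(h / 2))) ≤ (2 : ℝ≥0∞) ^ (4 * h) * 2 ^ ((l : ℝ) * -h) := by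
  have h1 : (2 : ℝ) ^ l ≤ 16 * ‖ξ‖ := by
    have h3 : 2 * Real.pi * ‖ξ‖ ≤ 8 * ‖ξ‖ := by
      have := Real.pi_le_four
      gcongr
      linarith
    have := hξ.1
    linarith [norm_nonneg ξ]
  have h2 : ((2 : ℝ) ^ (l - 4)) ^ 2 ≤ 1 + ‖ξ‖ ^ 2 := by
    have h3 : (2 : ℝ) ^ (l - 4) ≤ ‖ξ‖ := by
      rw [zpow_sub₀ two_ne_zero]
      norm_num
      linarith
    have := pow_le_pow_left₀ (by positivity) h3 2
    linarith
  have h4 : (1 + ‖ξ‖ ^ 2) ^ (-(h / 2)) ≤ (2 : ℝ) ^ (4 * h + (l : ℝ) * -h) := by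
    refine (Real.rpow_le_rpow_of_nonpos (by positivity) h2 (by linarith)).trans (le_of_eq ?_)
    rw [← Real.rpow_natCast, ← Real.rpow_intCast, ← Real.rpow_mul two_pos.le,
      ← Real.rpow_mul two_pos.le]
    congr 1
    push_cast
    ring
  rw [← two_rpow_add]
  refine (ENNReal.ofReal_le_ofReal h4).trans (le_of_eq ?_)
  rw [← ENNReal.ofReal_rpow_of_pos two_pos]
  simp

/-- A Besov bound with exponent at most `d/2` gives integrability against a negative power of
`1 + |ξ|²`. -/
theorem IsCutoff.lintegral_mul_rpow_lt_top (hχ : IsCutoff χ) (hd : 0 < d) {H : Rd d → ℝ≥0∞}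
    (hH : Measurable H) {σ : ℝ} (hσ : σ ≤ (d : ℝ) / 2)
    (hfin : ∑' l : ℤ, (2 : ℝ≥0∞) ^ ((l : ℝ) * σ) *
      l2norm ((dyadicAnnulus d l).indicator H) < ⊤) :
    ∫⁻ ξ, H ξ * ENNReal.ofReal ((1 + ‖ξ‖ ^ 2) ^ (-((d / 2 - σ) / 2))) < ⊤ := by
  have hm := fun l => (isClosed_dyadicAnnulus d l).measurableSet
  have h0 : (0 : ℝ) ≤ d / 2 - σ := by linarith
  have hterm : ∀ l : ℤ, ∫⁻ ξ, (dyadicAnnulus d l).indicator H ξ *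
      ENNReal.ofReal ((1 + ‖ξ‖ ^ 2) ^ (-((d / 2 - σ) / 2))) ≤
      2 ^ (4 * (d / 2 - σ)) * sqrtVolBall d * ((2 : ℝ≥0∞) ^ ((l : ℝ) * σ) *
        l2norm ((dyadicAnnulus d l).indicator H)) := by
    intro l
    calc _ ≤ ∫⁻ ξ, (dyadicAnnulus d l).indicator H ξ *
          ((2 : ℝ≥0∞) ^ (4 * (d / 2 - σ)) * 2 ^ ((l : ℝ) * -(d / 2 - σ))) := by
          refine lintegral_mono fun ξ => ?_
          by_cases hξ : ξ ∈ dyadicAnnulus d l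
          · dsimp only
            gcongr
            exact ofReal_one_add_sq_rpow_le hξ h0
          · simp [hξ]
      _ ≤ (sqrtVolBall d * (2 : ℝ≥0∞) ^ ((l : ℝ) * (d / 2)) *
            l2norm ((dyadicAnnulus d l).indicator H)) *
          ((2 : ℝ≥0∞) ^ (4 * (d / 2 - σ)) * 2 ^ ((l : ℝ) * -(d / 2 - σ))) := by
          rw [lintegral_mul_const _ (hH.indicator (hm l))]
          gcongr
          refine (lintegral_le_rpow_volume_mul_l2norm (hH.indicator (hm l)).aemeasurable (hm l)
            (Eventually.of_forall fun ξ hξ => by simp [hξ])).trans ?_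
          gcongr
          exact sqrt_volume_dyadicAnnulus_le d l
      _ = _ := by
          have : (l : ℝ) * σ = (l : ℝ) * (d / 2) + (l : ℝ) * -(d / 2 - σ) := by ring
          rw [this, two_rpow_add]
          ring
  calc _ ≤ ∫⁻ ξ, ∑' l : ℤ, (dyadicAnnulus d l).indicator H ξ *
        ENNReal.ofReal ((1 + ‖ξ‖ ^ 2) ^ (-((d / 2 - σ) / 2))) := by
        refine lintegral_mono_ae ?_
        filter_upwards [ae_ne_of_pos hd 0] with ξ hξ
        obtain ⟨l, hl⟩ : ∃ l : ℤ, symbol (annulus χ) l ξ ≠ 0 := by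
          by_contra! hall
          simpa [hall] using hχ.enorm_le_tsum_symbol_annulus hξ 1
        refine le_trans (le_of_eq ?_) (ENNReal.le_tsum l)
        rw [Set.indicator_of_mem (hχ.mem_dyadicAnnulus hl)]
    _ = ∑' l : ℤ, ∫⁻ ξ, (dyadicAnnulus d l).indicator H ξ *
        ENNReal.ofReal ((1 + ‖ξ‖ ^ 2) ^ (-((d / 2 - σ) / 2))) :=
        lintegral_tsum fun l => ((hH.indicator (hm l)).mul (by fun_prop)).aemeasurable
    _ ≤ _ := ENNReal.tsum_le_tsum hterm
    _ < ⊤ := by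
        rw [ENNReal.tsum_mul_left]
        exact ENNReal.mul_lt_top (ENNReal.mul_lt_top (two_rpow_ne_top _).lt_top
          (sqrtVolBall_lt_top d)) hfin

/-- Low-frequency summability in the critical space `Ḃ^{d/2}_{2,1}`, from a weighted sum whose
weights dominate the critical ones at low frequencies, gives the spectrum. -/
theorem IsCutoff.exists_isSpectrum_of_weight (hχ : IsCutoff χ) {u : Distr d} (hu : InSh χ u)
    {w : ℤ → ℝ≥0∞} (hw : ∀ l, w l ≠ 0)
    (hfin : ∑' l : ℤ, w l * lpNorm 2 (block χ l u) < ⊤)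
    (hK : ∀ n : ℤ, ∃ K : ℝ≥0∞, K ≠ ⊤ ∧ ∀ l ≤ n, (2 : ℝ≥0∞) ^ ((l : ℝ) * (d / 2)) ≤ K * w l) :
    ∃ U, IsSpectrum χ u U ∧ ∀ l,
      l2norm (fun ξ => ‖(symbol (annulus χ) l ξ : ℂ) * U ξ‖ₑ) = lpNorm 2 (block χ l u) := by
  have h2 : ∀ l, lpNorm 2 (block χ l u) < ⊤ := fun l => by
    have h1 := (ENNReal.le_tsum (f := fun l => w l * lpNorm 2 (block χ l u)) l).trans_lt hfin
    by_contra hne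
    rw [not_lt, top_le_iff] at hne
    simp [hne, ENNReal.mul_top (hw l)] at h1
  obtain ⟨U, hU⟩ := hχ.exists_isSpectrum hu h2 fun n => by
    obtain ⟨K, hKtop, hKle⟩ := hK n
    have hinj : Function.Injective fun k : ℕ => n - 1 - (k : ℤ) := fun a b hab => by
      simpa using hab
    refine ne_top_of_le_ne_top (ENNReal.mul_ne_top hKtop hfin.ne) ?_
    rw [← ENNReal.tsum_mul_left]
    refine le_trans (ENNReal.tsum_le_tsum fun k => ?_)
      (ENNReal.tsum_comp_le_tsum_of_injective hinj fun l => K * (w l * lpNorm 2 (block χ l u)))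
    rw [← mul_assoc]
    gcongr
    exact hKle _ (by lia)
  exact ⟨U, hU, fun l => hU.lpNorm_block hχ (h2 l)⟩

/-! ### The product as the inverse Fourier transform of a convolution -/

/-- The convolution of two complex functions. -/
def cconv (U V : Rd d → ℂ) : Rd d → ℂ := convolution U V (ContinuousLinearMap.mul ℂ ℂ) volume

theorem cconv_apply (U V : Rd d → ℂ) (ξ : Rd d) : cconv U V ξ = ∫ η, U η * V (ξ - η) := rfl

theorem enorm_cconv_le (U V : Rd d → ℂ) (ξ : Rd d) :
    ‖cconv U V ξ‖ₑ ≤ lconv (fun η => ‖U η‖ₑ) (fun η => ‖V η‖ₑ) ξ := by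
  rw [cconv_apply]
  refine (enorm_integral_le_lintegral_enorm _).trans (le_of_eq ?_)
  simp only [enorm_mul]
  rfl

theorem measurable_cconv {U V : Rd d → ℂ} (hU : Measurable U) (hV : Measurable V) :
    Measurable (cconv U V) :=
  (StronglyMeasurable.integral_prod_right' (f := fun p : Rd d × Rd d => U p.2 * V (p.1 - p.2))
    (by fun_prop : Measurable fun p : Rd d × Rd d => U p.2 * V (p.1 - p.2)).stronglyMeasurable
    ).measurable

/-- The multiplier `(1 + |ξ|²)^r`, as a complex function. -/
def bracket (d : ℕ) (r : ℝ) (ξ : Rd d) : ℂ := (((1 + ‖ξ‖ ^ 2) ^ r : ℝ) : ℂ)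

theorem bracket_hasTemperateGrowth (d : ℕ) (r : ℝ) : (bracket d r).HasTemperateGrowth :=
  Function.HasTemperateGrowth.comp Function.Complex.hasTemperateGrowth_ofReal
    (Function.hasTemperateGrowth_one_add_norm_sq_rpow _ r)

theorem bracket_mul_bracket_neg (r : ℝ) (ξ : Rd d) : bracket d r ξ * bracket d (-r) ξ = 1 := by
  rw [bracket, bracket, ← Complex.ofReal_mul, ← Real.rpow_add (by positivity)]
  simp

theorem enorm_bracket (r : ℝ) (ξ : Rd d) :
    ‖bracket d r ξ‖ₑ = ENNReal.ofReal ((1 + ‖ξ‖ ^ 2) ^ r) := by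
  rw [bracket, ← ofReal_norm, Complex.norm_real, Real.norm_of_nonneg (by positivity)]

/-- A function that is integrable against a negative power of `1 + |ξ|²` is the Fourier transform
of a tempered distribution. -/
theorem exists_isFunction_fourier {W : Rd d → ℂ} {r : ℝ}
    (hfin : Integrable fun ξ => bracket d (-r) ξ * W ξ) :
    ∃ w : Distr d, IsFunction (𝓕 w) W := by
  refine ⟨𝓕⁻ (TemperedDistribution.smulLeftCLM ℂ (bracket d r)
    ((memLp_one_iff_integrable.2 hfin).toLp _ : Lp ℂ 1 (volume : Measure (Rd d)))), ?_⟩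
  rw [FourierTransform.fourier_fourierInv_eq]
  have h := (isFunction_toLp (memLp_one_iff_integrable.2 hfin)).smulLeft
    (bracket_hasTemperateGrowth d r)
  refine h.congr_ae (Eventually.of_forall fun ξ => ?_)
  dsimp only
  rw [← mul_assoc, bracket_mul_bracket_neg, one_mul]

/-- Schwartz functions decay faster than any power of `1 + |ξ|²`. -/
theorem exists_norm_schwartz_le (ψ : 𝓢(Rd d, ℂ)) (r : ℝ) :
    ∃ C : ℝ≥0∞, C ≠ ⊤ ∧ ∀ ξ, ‖ψ ξ‖ₑ ≤ C * ‖bracket d (-r) ξ‖ₑ := by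
  let ψ' := SchwartzMap.smulLeftCLM ℂ (bracket d r) ψ
  obtain ⟨C, hC⟩ := ψ'.decay 0 0
  refine ⟨ENNReal.ofReal C, ENNReal.ofReal_ne_top, fun ξ => ?_⟩
  have h1 : ψ ξ = ψ' ξ * bracket d (-r) ξ := by
    have : ψ' ξ = bracket d r ξ * ψ ξ :=
      SchwartzMap.smulLeftCLM_apply_apply (bracket_hasTemperateGrowth d r) ψ ξ
    rw [this, mul_right_comm, bracket_mul_bracket_neg, one_mul]
  rw [h1, enorm_mul]
  gcongr
  rw [← ofReal_norm]
  exact ENNReal.ofReal_le_ofReal (by simpa using hC.2 ξ)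

theorem apply_eq_integral_of_fourier {T : Distr d} {f : Rd d → ℂ} (h : IsFunction (𝓕 T) f)
    (ψ : 𝓢(Rd d, ℂ)) : T ψ = ∫ ξ, (𝓕⁻ ψ) ξ * f ξ := by
  rw [← (h.2 _).2, TemperedDistribution.fourier_apply, FourierTransform.fourier_fourierInv_eq]

/-- The product of two distributions with integrable Fourier transforms `f` and `g` is the function
whose Fourier transform is the convolution of `f` and `g`. -/
theorem IsPointwiseProduct.exists_of_fourier {T T' : Distr d} {f g : Rd d → ℂ}
    (hf : IsFunction (𝓕 T) f) (hg : IsFunction (𝓕 T') g) (hfi : Integrable f)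
    (hgi : Integrable g) :
    ∃ a : Distr d, IsPointwiseProduct T T' a ∧ IsFunction (𝓕 a) (cconv f g) := by
  have hint : Integrable (cconv f g) := hfi.integrable_convolution _ hgi
  have hLp := memLp_one_iff_integrable.2 hint
  have ha : IsFunction (𝓕 (𝓕⁻ (hLp.toLp _ : Distr d))) (cconv f g) := by
    rw [FourierTransform.fourier_fourierInv_eq]
    exact isFunction_toLp hLp
  refine ⟨𝓕⁻ (hLp.toLp _ : Distr d), ⟨𝓕⁻ f, 𝓕⁻ g, hf.of_fourier_integrable hfi,
    hg.of_fourier_integrable hgi, ?_⟩, ha⟩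
  convert ha.of_fourier_integrable hint using 2 with x
  simp only [Real.fourierInv_eq_fourier_neg]
  exact (Real.fourier_mul_convolution_eq hfi hgi (-x)).symm

/-- If the convolution of the spectra converges absolutely and is tempered, then the product
exists, and its Fourier transform is this convolution. -/
theorem IsSpectrum.exists_isProduct (hχ : IsCutoff χ) (hd : 0 < d) {u v : Distr d}
    {U V : Rd d → ℂ} (hU : IsSpectrum χ u U) (hV : IsSpectrum χ v V) {r : ℝ}
    (hfin : ∫⁻ ξ, lconv (fun η => ‖U η‖ₑ) (fun η => ‖V η‖ₑ) ξ * ‖bracket d (-r) ξ‖ₑ < ⊤) :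
    ∃ w : Distr d, IsProduct χ u v w ∧ IsFunction (𝓕 w) (cconv U V) := by
  set H := lconv (fun η => ‖U η‖ₑ) (fun η => ‖V η‖ₑ) with hHdef
  have hH : Measurable H := measurable_lconv hU.measurable.enorm hV.measurable.enorm
  have hbr : Measurable (bracket d (-r)) :=
    (bracket_hasTemperateGrowth d (-r)).1.continuous.measurable
  have hW := measurable_cconv hU.measurable hV.measurable
  obtain ⟨w, hw⟩ := exists_isFunction_fourier (W := cconv U V) (r := r)
    ⟨(hbr.mul hW).aestronglyMeasurable, by
    refine lt_of_le_of_lt (lintegral_mono fun ξ => ?_) hfin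
    rw [enorm_mul, mul_comm]
    gcongr
    exact enorm_cconv_le U V ξ⟩
  choose a ha ha' using fun n : ℤ => IsPointwiseProduct.exists_of_fourier (hU.isFunction n)
    (hV.isFunction n) (hU.integrable n) (hV.integrable n)
  have hHfin : ∀ᵐ ξ, H ξ < ⊤ := by
    filter_upwards [ae_lt_top (hH.mul hbr.enorm) hfin.ne] with ξ hξ
    refine lt_top_iff_ne_top.2 fun htop => ?_
    have h0 : ‖bracket d (-r) ξ‖ₑ ≠ 0 := by
      rw [enorm_bracket]
      exact (ENNReal.ofReal_pos.2 (by positivity)).ne'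
    rw [Pi.mul_apply, htop, ENNReal.top_mul h0] at hξ
    exact hξ.ne rfl
  have hχm : ∀ n : ℤ, Measurable fun ξ : Rd d => (symbol χ n ξ : ℂ) := fun n =>
    Complex.measurable_ofReal.comp (hχ.symbol_continuous n).measurable
  have hχle : ∀ (n : ℤ) (ξ : Rd d) (z : ℂ), ‖(symbol χ n ξ : ℂ) * z‖ₑ ≤ ‖z‖ₑ := fun n ξ z => by
    rw [← ofReal_norm, ← ofReal_norm, norm_mul, Complex.norm_real,
      Real.norm_of_nonneg (hχ.symbol_nonneg hd n ξ)]
    exact ENNReal.ofReal_le_ofReal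
      (mul_le_of_le_one_left (norm_nonneg z) (hχ.symbol_le_one n ξ))
  refine ⟨w, ⟨a, ha, PointwiseConvergenceCLM.tendsto_iff_forall_tendsto.2 fun ψ => ?_⟩, hw⟩
  simp only [fun n => apply_eq_integral_of_fourier (ha' n) ψ, apply_eq_integral_of_fourier hw ψ]
  refine tendsto_integral_filter_of_dominated_convergence
    (fun ξ => (‖(𝓕⁻ ψ) ξ‖ₑ * H ξ).toReal) ?_ ?_ ?_ ?_
  · exact Eventually.of_forall fun n => ((𝓕⁻ ψ).continuous.measurable.mul (measurable_cconv
      ((hχm n).mul hU.measurable) ((hχm n).mul hV.measurable))).aestronglyMeasurable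
  · refine Eventually.of_forall fun n => ?_
    filter_upwards [hHfin] with ξ hξ
    rw [← toReal_enorm, enorm_mul]
    refine ENNReal.toReal_mono (ENNReal.mul_ne_top enorm_ne_top hξ.ne) ?_
    gcongr
    refine (enorm_cconv_le _ _ ξ).trans (lintegral_mono fun η => ?_)
    exact mul_le_mul' (hχle n η _) (hχle n (ξ - η) _)
  · refine integrable_toReal_of_lintegral_ne_top
      ((𝓕⁻ ψ).continuous.measurable.enorm.mul hH).aemeasurable ?_
    obtain ⟨C, hC, hCle⟩ := exists_norm_schwartz_le (𝓕⁻ ψ) r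
    refine ne_top_of_le_ne_top (ENNReal.mul_ne_top hC hfin.ne) ?_
    rw [← lintegral_const_mul' _ _ hC]
    refine lintegral_mono fun ξ => ?_
    calc ‖(𝓕⁻ ψ) ξ‖ₑ * H ξ ≤ C * ‖bracket d (-r) ξ‖ₑ * H ξ := by gcongr; exact hCle ξ
      _ = _ := by ring
  · filter_upwards [hHfin] with ξ hξ
    refine Tendsto.const_mul _ ?_
    simp only [cconv_apply]
    refine tendsto_integral_filter_of_dominated_convergence
      (fun η => ‖U η * V (ξ - η)‖) ?_ ?_ ?_ ?_
    · have hsub : Measurable fun η : Rd d => ξ - η := measurable_const.sub measurable_id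
      exact Eventually.of_forall fun n => (((hχm n).mul hU.measurable).mul
        (((hχm n).mul hV.measurable).comp hsub)).aestronglyMeasurable
    · refine Eventually.of_forall fun n => Eventually.of_forall fun η => ?_
      rw [← toReal_enorm, ← toReal_enorm]
      refine ENNReal.toReal_mono enorm_ne_top ?_
      rw [enorm_mul, enorm_mul (U η)]
      exact mul_le_mul' (hχle n η _) (hχle n (ξ - η) _)
    · refine Integrable.norm ⟨(hU.measurable.mul (hV.measurable.comp
        (measurable_const.sub measurable_id))).aestronglyMeasurable, lt_of_eq_of_lt ?_ hξ⟩
      simp only [enorm_mul]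
      rfl
    · refine Eventually.of_forall fun η => tendsto_const_nhds.congr' ?_
      filter_upwards [hχ.eventually_symbol_eq_one η, hχ.eventually_symbol_eq_one (ξ - η)]
        with n h1 h2
      rw [h1, h2, Complex.ofReal_one, one_mul, one_mul]

/-- A tempered distribution whose Fourier transform is a locally integrable function belongs to
`𝓢'_h`. -/
theorem IsCutoff.inSh_of_fourier (hχ : IsCutoff χ) (hd : 0 < d) {w : Distr d} {W : Rd d → ℂ}
    (hw : IsFunction (𝓕 w) W) : InSh χ w := by
  have hfun : ∀ q : ℤ, IsFunction (𝓕 (lowFreq χ q w)) fun ξ => (symbol χ q ξ : ℂ) * W ξ :=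
    fun q => by
      rw [fourier_lowFreq]
      exact hw.smulLeft (hχ.symbol_hasTemperateGrowth q)
  have hint : ∀ q : ℤ, Integrable fun ξ => (symbol χ q ξ : ℂ) * W ξ := fun q =>
    hw.1.integrable_smul_left_of_hasCompactSupport
      (Complex.continuous_ofReal.comp (hχ.symbol_continuous q))
      ((hχ.symbol_hasCompactSupport q).comp_left Complex.ofReal_zero)
  have hlim : Tendsto (fun q : ℤ => ∫⁻ ξ, ‖(symbol χ q ξ : ℂ) * W ξ‖ₑ) atBot
      (𝓝 (∫⁻ _ : Rd d, 0)) := by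
    refine tendsto_lintegral_filter_of_dominated_convergence'
      (fun ξ => ‖(symbol χ 0 ξ : ℂ) * W ξ‖ₑ) (Eventually.of_forall fun q => (hint q).1.enorm)
      ?_ (hint 0).2.ne ?_
    · filter_upwards [eventually_le_atBot 0] with q hq
      refine Eventually.of_forall fun ξ => ?_
      rw [enorm_mul, enorm_mul]
      gcongr
      rw [← ofReal_norm, ← ofReal_norm, Complex.norm_real, Complex.norm_real,
        Real.norm_of_nonneg (hχ.symbol_nonneg hd _ _),
        Real.norm_of_nonneg (hχ.symbol_nonneg hd _ _)]
      exact ENNReal.ofReal_le_ofReal (hχ.symbol_mono hq ξ)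
    · filter_upwards [ae_ne_of_pos hd 0] with ξ hξ
      refine tendsto_const_nhds.congr' ?_
      filter_upwards [hχ.eventually_symbol_eq_zero hξ] with q hq
      simp [hq]
  rw [lintegral_zero] at hlim
  exact tendsto_of_tendsto_of_tendsto_of_le_of_le tendsto_const_nhds hlim (fun _ => zero_le)
    fun q => lpNorm_top_le (hfun q) (hint q)

theorem IsCutoff.lpNorm_block_le (hχ : IsCutoff χ) (hd : 0 < d) {w : Distr d} {W : Rd d → ℂ}
    (hw : IsFunction (𝓕 w) W) {H : Rd d → ℝ≥0∞} (hWH : ∀ ξ, ‖W ξ‖ₑ ≤ H ξ) (l : ℤ) :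
    lpNorm 2 (block χ l w) ≤ l2norm ((dyadicAnnulus d l).indicator H) := by
  rcases eq_top_or_lt_top (l2norm ((dyadicAnnulus d l).indicator H)) with htop | hlt
  · rw [htop]
    exact le_top
  have hfun : IsFunction (𝓕 (block χ l w)) fun ξ => (symbol (annulus χ) l ξ : ℂ) * W ξ := by
    rw [fourier_block]
    exact hw.smulLeft (hχ.symbol_annulus_hasTemperateGrowth l)
  have hle : eLpNorm (fun ξ => (symbol (annulus χ) l ξ : ℂ) * W ξ) 2 volume
      ≤ l2norm ((dyadicAnnulus d l).indicator H) := by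
    rw [eLpNorm_two_eq_l2norm]
    refine l2norm_mono (Eventually.of_forall fun ξ => ?_)
    by_cases hξ : ξ ∈ dyadicAnnulus d l
    · rw [Set.indicator_of_mem hξ]
      refine le_trans ?_ (hWH ξ)
      rw [← ofReal_norm, ← ofReal_norm, norm_mul, Complex.norm_real,
        Real.norm_of_nonneg (hχ.symbol_annulus_nonneg l ξ)]
      exact ENNReal.ofReal_le_ofReal
        (mul_le_of_le_one_left (norm_nonneg _) (hχ.symbol_annulus_le_one hd l ξ))
    · rw [hχ.symbol_annulus_mul_eq_zero W l ξ hξ]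
      exact zero_le
  rw [lpNorm_two_eq hfun ⟨hfun.1.aestronglyMeasurable, hle.trans_lt hlt⟩]
  exact hle

/-! ### The product law in hybrid Besov spaces -/

/-- The weight of the `l`-th dyadic block in the norm of the hybrid space with threshold `L`. -/
def hybridWeight (ε : ℝ) (L : ℤ) (s t : ℝ) (l : ℤ) : ℝ≥0∞ :=
  if l ≤ L then 2 ^ ((l : ℝ) * s) else ENNReal.ofReal (1 / ε ^ 2) * 2 ^ ((l : ℝ) * t)

theorem hybridNorm_eq_tsum (χ : Rd d → ℝ) (ε : ℝ) (L : ℤ) (s t : ℝ) (u : Distr d) :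
    hybridNorm χ ε L s t u = ∑' l : ℤ, hybridWeight ε L s t l * lpNorm 2 (block χ l u) := by
  refine (congrArg₂ (· + ·) (tsum_subtype {l : ℤ | l ≤ L}
      (fun l : ℤ => (2 : ℝ≥0∞) ^ ((l : ℝ) * s) * lpNorm 2 (block χ l u)))
    (tsum_subtype {l : ℤ | L < l} (fun l : ℤ => ENNReal.ofReal (1 / ε ^ 2) *
      ((2 : ℝ≥0∞) ^ ((l : ℝ) * t) * lpNorm 2 (block χ l u))))).trans ?_
  rw [← ENNReal.tsum_add]
  refine tsum_congr fun l => ?_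
  by_cases hl : l ≤ L
  · simp [hybridWeight, hl, not_lt.2 hl]
  · simp [hybridWeight, hl, not_le.1 hl, mul_assoc]

/-- Below a fixed frequency a weight with a smaller exponent dominates the critical one. -/
theorem two_rpow_mul_le {l n : ℤ} (hln : l ≤ n) {s h : ℝ} (hs : s ≤ h) :
    (2 : ℝ≥0∞) ^ ((l : ℝ) * h) ≤ 2 ^ ((n : ℝ) * (h - s)) * 2 ^ ((l : ℝ) * s) := by
  rw [← two_rpow_add]
  refine ENNReal.rpow_le_rpow_of_exponent_le one_le_two ?_
  have : (l : ℝ) ≤ n := by exact_mod_cast hln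
  nlinarith

/-- The product law for single dyadic blocks, with the two scales of estimates merged: the
`Ḃ^{s-1} × Ḃ^{t+1}` law below the threshold of the second factor, and the `Ḃ^s × Ḃ^t` law
above it. -/
theorem exists_hybrid_block_bound (d : ℕ) {s t : ℝ} (hs : s ≤ (d : ℝ) / 2)
    (ht : t ≤ (d : ℝ) / 2 - 1) (hst : 0 < s + t) (ε₀ : ℝ) :
    ∃ K : ℝ≥0∞, K < ⊤ ∧ ∀ ε : ℝ, 0 < ε → ε ≤ ε₀ → ∀ (L j k : ℤ) (F G : Rd d → ℝ≥0∞),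
      Measurable F → Measurable G →
      (∀ ξ ∉ dyadicAnnulus d j, F ξ = 0) → (∀ ξ ∉ dyadicAnnulus d k, G ξ = 0) →
      ∑' l : ℤ, (2 : ℝ≥0∞) ^ ((l : ℝ) * (s + t - d / 2)) *
          l2norm ((dyadicAnnulus d l).indicator (lconv F G))
        ≤ K * ((2 ^ ((j : ℝ) * (s - 1)) + 2 ^ ((j : ℝ) * s)) * l2norm F *
          (hybridWeight ε L (t + 1) t k * l2norm G)) := by
  obtain ⟨C₁, hC₁, h₁⟩ := exists_tsum_l2norm_indicator_lconv_le d hs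
    (by linarith : t ≤ (d : ℝ) / 2) hst
  obtain ⟨C₂, hC₂, h₂⟩ := exists_tsum_l2norm_indicator_lconv_le d
    (by linarith : s - 1 ≤ (d : ℝ) / 2) (by linarith : t + 1 ≤ (d : ℝ) / 2)
    (by linarith : 0 < s - 1 + (t + 1))
  have hexp : s - 1 + (t + 1) - (d : ℝ) / 2 = s + t - d / 2 := by ring
  rw [hexp] at h₂
  refine ⟨C₁ * ENNReal.ofReal (ε₀ ^ 2) + C₂, ENNReal.add_lt_top.2
    ⟨ENNReal.mul_lt_top hC₁ ENNReal.ofReal_lt_top, hC₂⟩,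
    fun ε hε hε₀ L j k F G hF hG hFj hGk => ?_⟩
  by_cases hk : k ≤ L
  · rw [hybridWeight, if_pos hk]
    refine (h₂ j k F G hF hG hFj hGk).trans ?_
    gcongr
    · exact le_add_self
    · exact le_self_add
  · -- The weight `1/ε²` is bounded below since `ε ≤ ε₀`.
    rw [hybridWeight, if_neg hk]
    refine (h₁ j k F G hF hG hFj hGk).trans ?_
    have hone : 1 ≤ ENNReal.ofReal (ε₀ ^ 2) * ENNReal.ofReal (1 / ε ^ 2) := by
      rw [← ENNReal.ofReal_mul (by positivity), ENNReal.one_le_ofReal, mul_one_div,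
        one_le_div (by positivity)]
      gcongr
    calc C₁ * (2 ^ ((j : ℝ) * s) * l2norm F * (2 ^ ((k : ℝ) * t) * l2norm G))
        = C₁ * 1 * (2 ^ ((j : ℝ) * s) * l2norm F * (2 ^ ((k : ℝ) * t) * l2norm G)) := by
          rw [mul_one]
      _ ≤ C₁ * (ENNReal.ofReal (ε₀ ^ 2) * ENNReal.ofReal (1 / ε ^ 2)) *
          (2 ^ ((j : ℝ) * s) * l2norm F * (2 ^ ((k : ℝ) * t) * l2norm G)) := by
          gcongr
      _ = C₁ * ENNReal.ofReal (ε₀ ^ 2) * (2 ^ ((j : ℝ) * s) * l2norm F *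
          (ENNReal.ofReal (1 / ε ^ 2) * 2 ^ ((k : ℝ) * t) * l2norm G)) := by ring
      _ ≤ _ := by
          gcongr
          · exact le_self_add
          · exact le_add_self

end LPBesov

end

open LPBesov in
theorem mainTheorem5 (d : ℕ) (χ : LPBesov.Rd d → ℝ) (hχ : LPBesov.IsCutoff χ) (s t : ℝ)
    (hs : s ≤ (d : ℝ) / 2) (ht : t ≤ (d : ℝ) / 2 - 1) (hst : 0 < s + t) (ε₀ : ℝ) (hε₀ : 0 < ε₀) :
    ∃ C : ℝ, 0 < C ∧ ∀ ε : ℝ, 0 < ε → ε ≤ ε₀ → ∀ L : ℤ, ∀ u v : LPBesov.Distr d,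
      LPBesov.InBesov χ (s - 1) u → LPBesov.InBesov χ s u →
      LPBesov.InHybrid χ ε L (t + 1) t v →
      ∃ w : LPBesov.Distr d, LPBesov.IsProduct χ u v w ∧
        LPBesov.InBesov χ (s + t - (d : ℝ) / 2) w ∧
        LPBesov.besovNorm χ (s + t - (d : ℝ) / 2) w ≤
          ENNReal.ofReal C *
            (LPBesov.besovNorm χ (s - 1) u + LPBesov.besovNorm χ s u) *
            LPBesov.hybridNorm χ ε L (t + 1) t v := by
  -- The hypotheses force `s + t ≤ d - 1`, hence `d ≥ 2`.
  have hd : 0 < d := by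
    have : (0 : ℝ) < d := by linarith
    exact_mod_cast this
  obtain ⟨K, hKtop, hK⟩ := exists_hybrid_block_bound d hs ht hst ε₀
  refine ⟨K.toReal + 1, by positivity, fun ε hε hεε₀ L u v hu₁ hu₂ hv => ?_⟩
  have hεpos : 0 < ENNReal.ofReal (1 / ε ^ 2) := ENNReal.ofReal_pos.2 (by positivity)
  have hw0 : ∀ l, hybridWeight ε L (t + 1) t l ≠ 0 := fun l => by
    unfold hybridWeight
    split_ifs
    · exact (two_rpow_pos _).ne'
    · exact mul_ne_zero hεpos.ne' (two_rpow_pos _).ne'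
  obtain ⟨U, hU, hUnorm⟩ := hχ.exists_isSpectrum_of_weight hu₂.1
    (w := fun l => (2 : ℝ≥0∞) ^ ((l : ℝ) * s)) (fun l => (two_rpow_pos _).ne') hu₂.2
    fun n => ⟨_, two_rpow_ne_top _, fun l hl => two_rpow_mul_le hl hs⟩
  have hvfin := hv.2
  rw [hybridNorm_eq_tsum] at hvfin
  -- The constant comparing the hybrid weight with the critical one depends on `ε`, but serves only
  -- to prove that a sum is finite.
  obtain ⟨V, hV, hVnorm⟩ := hχ.exists_isSpectrum_of_weight hv.1 hw0 hvfin fun n => by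
    refine ⟨2 ^ ((n : ℝ) * (d / 2 - (t + 1))) +
      2 ^ ((n : ℝ) * (d / 2 - t)) * (ENNReal.ofReal (1 / ε ^ 2))⁻¹,
      ENNReal.add_ne_top.2 ⟨two_rpow_ne_top _, ENNReal.mul_ne_top (two_rpow_ne_top _)
        (ENNReal.inv_ne_top.2 hεpos.ne')⟩, fun l hl => ?_⟩
    unfold hybridWeight
    split_ifs
    · refine (two_rpow_mul_le hl (by linarith : t + 1 ≤ (d : ℝ) / 2)).trans ?_
      gcongr
      exact le_self_add
    · refine (two_rpow_mul_le hl (by linarith : t ≤ (d : ℝ) / 2)).trans ?_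
      calc _ = 2 ^ ((n : ℝ) * (d / 2 - t)) *
            ((ENNReal.ofReal (1 / ε ^ 2))⁻¹ * ENNReal.ofReal (1 / ε ^ 2)) *
              2 ^ ((l : ℝ) * t) := by
            rw [ENNReal.inv_mul_cancel hεpos.ne' ENNReal.ofReal_ne_top, mul_one]
        _ = 2 ^ ((n : ℝ) * (d / 2 - t)) * (ENNReal.ofReal (1 / ε ^ 2))⁻¹ *
              (ENNReal.ofReal (1 / ε ^ 2) * 2 ^ ((l : ℝ) * t)) := by ring
        _ ≤ _ := by
            gcongr
            exact le_add_self
  have hmain := hχ.tsum_l2norm_lconv_le hd hU.measurable hV.measurable (hK ε hε hεε₀ L)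
  simp only [hUnorm, hVnorm, add_mul, ENNReal.tsum_add] at hmain
  rw [← hybridNorm_eq_tsum] at hmain
  change _ ≤ K * (besovNorm χ (s - 1) u + besovNorm χ s u) * _ at hmain
  have hfin : K * (besovNorm χ (s - 1) u + besovNorm χ s u) * hybridNorm χ ε L (t + 1) t v < ⊤ :=
    ENNReal.mul_lt_top (ENNReal.mul_lt_top hKtop (ENNReal.add_lt_top.2 ⟨hu₁.2, hu₂.2⟩)) hv.2
  have hsum := hmain.trans_lt hfin
  have htemp := hχ.lintegral_mul_rpow_lt_top hd (measurable_lconv hU.measurable.enorm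
    hV.measurable.enorm) (by linarith : s + t - (d : ℝ) / 2 ≤ d / 2) hsum
  simp only [← enorm_bracket] at htemp
  obtain ⟨w, hw, hwf⟩ := hU.exists_isProduct hχ hd hV htemp
  have hle : besovNorm χ (s + t - (d : ℝ) / 2) w ≤
      K * (besovNorm χ (s - 1) u + besovNorm χ s u) * hybridNorm χ ε L (t + 1) t v := by
    refine le_trans (ENNReal.tsum_le_tsum fun l => ?_) hmain
    gcongr
    exact hχ.lpNorm_block_le hd hwf (enorm_cconv_le U V) l
  refine ⟨w, hw, ⟨hχ.inSh_of_fourier hd hwf, hle.trans_lt hfin⟩, hle.trans ?_⟩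
  gcongr
  rw [← ENNReal.ofReal_toReal hKtop.ne]
  exact ENNReal.ofReal_le_ofReal (by simp)
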